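/- Let $q$ be a prime power. For every $n$ let $v_1,v_2,\ldots$ be independent uniformly random vectors in $\mathbb{F}_q^n$, let $A_m=[v_1,\ldots,v_m]$, and let $M[A_m]$ be the matroid on the column indices $\{1,\dots,m\}$ in which a set is independent iff the corresponding columns are linearly independent. A vertical $\ell$-separation of a matroid $M$ is a partition $(X,Y)$ of its ground set with $\min\{\mathrm{rk}(X),\mathrm{rk}(Y)\}\ge \ell$ and $\mathrm{rk}(X)+\mathrm{rk}(Y)-\mathrm{rk}(M)\le \ell-1$. The vertical connectivity $\kappa(M)$ is the smallest $\ell$ for which $M$ has a vertical $\ell$-separation ($\kappa(M)=\infty$ if there is none), and $M$ is vertically $k$-connected if $\kappa(M)\ge k$. Let $\tau_{k\text{-conn}}\in\{2,3,\ldots\}\cup\{\infty\}$ be the smallest $m\ge 2$ such that $M[A_m]$ is vertically $k$-connected. An event (depending on $n$) holds a.a.s. if its probability tends to $1$ as $n\to\infty$. Theorem. Fix $q$, and let $k=k(n)$ be a sequence of nonnegative integers. (a) If $k\to\infty$ and $k=o(n)$, then a.a.s. $\tau_{k\text{-conn}}-n\sim k\log_q(n/k)$; that is, for every fixed $\varepsilon>0$,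 a.a.s. $\tau_{k\text{-conn}}<\infty$ and $$\bigl|\tau_{k\text{-conn}}-n-k\log_q(n/k)\bigr|\le \varepsilon\,k\log_q(n/k).$$ (b) If $k\sim tn$ for a fixed $0<t<1$, then a.a.s. $\tau_{k\text{-conn}}\ge(1+\alpha)n$ for every constant $\alpha$ satisfying $$t\log\frac{1+\alpha}{t}+(1+\alpha-t)\log\frac{1+\alpha}{1+\alpha-t}+t\log(q-1)-\alpha\log q>0 .$$ -/

import Mathlib

open Filter Topology MeasureTheory ProbabilityTheory

noncomputable section

/-- The matroid `M[A]` represented by a matrix `A` over a field: the ground set is the set of all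
column indices, and a set of indices is independent iff the columns it indexes form a linearly
independent family. -/
def representedMatroid {F ι κ : Type*} [Field F] [Finite κ] (A : Matrix ι κ F) : Matroid κ :=
  (IndepMatroid.ofFinite (E := Set.univ) Set.finite_univ
    (fun I => LinearIndepOn F A.col I)
    (linearIndepOn_empty F A.col)
    (fun _ _ hJ hIJ => hJ.mono hIJ)
    (by
      intro I J hI hJ hlt
      by_contra! hcon
      have hsub : A.col '' J ⊆ Submodule.span F (A.col '' I) := by
        rintro _ ⟨e, heJ, rfl⟩
        by_cases heI : e ∈ I
        · exact Submodule.subset_span ⟨e, heI, rfl⟩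
        · by_contra hspan
          exact hcon e heJ heI (hI.insert hspan)
      have hle : Submodule.span F (A.col '' J) ≤ Submodule.span F (A.col '' I) :=
        Submodule.span_le.mpr hsub
      have key : ∀ K : Set κ, LinearIndepOn F A.col K →
          Module.finrank F (Submodule.span F (A.col '' K)) = K.ncard := by
        intro K hK
        have := Fintype.ofFinite K
        have h := finrank_span_eq_card hK
        rw [Set.image_eq_range, h, Set.ncard_eq_toFinset_card', Set.toFinset_card]
      have hfin : Module.Finite F (Submodule.span F (A.col '' I)) :=
        Module.Finite.span_of_finite F (Set.toFinite _)
      have := Submodule.finrank_mono hle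
      rw [key I hI, key J hJ] at this
      omega)
    (fun _ _ => Set.subset_univ _)).matroid

/-- `(X, Y)` is a vertical `k`-separation of `M`: a partition of the ground set with
`min (rk X) (rk Y) ≥ k` and `rk X + rk Y - rk M ≤ k - 1` (written without subtraction). -/
def IsVerticalSeparation {κ : Type*} (M : Matroid κ) (k : ℕ) (X Y : Set κ) : Prop :=
  X ∪ Y = M.E ∧ Disjoint X Y ∧
    (k : ℕ∞) ≤ min (M.eRk X) (M.eRk Y) ∧ M.eRk X + M.eRk Y + 1 ≤ M.eRank + k

/-- The vertical connectivity of `M`: the smallest `k` for which `M` has a vertical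
`k`-separation, and `⊤` if there is none. -/
def verticalConnectivity {κ : Type*} (M : Matroid κ) : ℕ∞ :=
  ⨅ (k : ℕ) (_ : ∃ X Y, IsVerticalSeparation M k X Y), (k : ℕ∞)

/-- `M` is vertically `k`-connected: it has no vertical `l`-separation with `l < k`. -/
def IsVerticallyConnected {κ : Type*} (M : Matroid κ) (k : ℕ) : Prop :=
  (k : ℕ∞) ≤ verticalConnectivity M

/-- The `n × m` matrix whose columns are the first `m` vectors of the sequence `v`. -/
def columnMatrix {F : Type*} {n : ℕ} (v : ℕ → Fin n → F) (m : ℕ) : Matrix (Fin n) (Fin m) F :=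
  Matrix.of fun i j => v j i

/-- The time `τ_{k-conn}` of the sequence `v`: the smallest `m ≥ 2` such that `M[A_m]` is
vertically `k`-connected (`⊤` if there is none). Matroids with at most one element, which have no
vertical separation at all for the trivial reason that they have no partition into two nonempty
sets, are disregarded. -/
def connTime {F : Type*} [Field F] {n : ℕ} (v : ℕ → Fin n → F) (k : ℕ) : ℕ∞ :=
  ⨅ (m : ℕ) (_ : 2 ≤ m ∧ IsVerticallyConnected (representedMatroid (columnMatrix v m)) k),
    (m : ℕ∞)

/-- `v 0, v 1, …` are independent random vectors, each uniformly distributed on `F ^ n`. -/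
structure IsUniformColumnSequence {Ω F : Type*} [MeasurableSpace Ω] [Fintype F]
    [MeasurableSpace F] {n : ℕ} (P : Measure Ω) (v : ℕ → Ω → Fin n → F) : Prop where
  measurable : ∀ i, Measurable (v i)
  uniform : ∀ i, P.map (v i) = uniformOn Set.univ
  indep : iIndepFun v P

/-- Asymptotically almost surely: the probability of the `n`-th event tends to `1`. -/
def AAS {Ω : ℕ → Type*} [∀ n, MeasurableSpace (Ω n)] (P : ∀ n, Measure (Ω n))
    (E : ∀ n, Set (Ω n)) : Prop :=
  Tendsto (fun n => P n (E n)) atTop (𝓝 1)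

end

/-! The governing quantity is the expected number of words of weight below `k` in the row space of
`A_m`, which is at least about `q^(n-m) * C(m,k-1) * (q-1)^(k-1)`. If `y ≠ 0` and `yA` has support
`X`, the columns outside `X` lie in the hyperplane orthogonal to `y`; when `A` has rank `n` and `|X|
< k ≤ n`, neither `X` nor its complement spans, and this gives a vertical separation of order below
`k`.

Lower bounds (both parts): the words `yA` are uniform, and independent for non-proportional `y`, so
Chebyshev produces a light word once the expectation tends to infinity
(`tendsto_compl_lt_connTime`). Every time `m' ≤ m` has to be excluded. A light word at time `m`
stays light when truncated to `m' > n + w`, with `w = k/4`. For `m' ≤ n + w`, the first `min(m',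
n-w)` columns are typically independent, and all of them but one form a nonspanning set with small
complement (`not_isVerticallyConnected_columnMatrix`). In (a) the expectation is estimated by
`(m/j)^j ≤ C(m,j)`, in (b) by Stirling, whose exponent is the stated expression.

Upper bound in (a): at the single time `m = n + δ`, `δ ≈ (1+ε) k log_q(n/k)`, a union bound is taken
over all column sets `X` and all rank pairs of `X` and its complement. A uniform matrix with row
corank `u` and column nullity `d` has probability at most `2^min(u,d) q^(-ud)`. Summing over `X`
leaves `θ^u`, `θ = 2 (em/k)^k q^(-(δ-k))`, where `u ≥ 1` is the corank of the larger side
(`sum_dens_colRank_le`); then `kθ → 0`. -/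

/-- The proportion of elements of a finite type which lie in `S`. -/
noncomputable def dens {α : Type*} (S : Set α) : ℝ := (S.ncard : ℝ) / Nat.card α

/-! ### Uniform probability on finite types. -/

section Dens

variable {α β ι : Type*}

lemma dens_nonneg (S : Set α) : 0 ≤ dens S := by unfold dens; positivity

lemma dens_mono [Finite α] {S T : Set α} (h : S ⊆ T) : dens S ≤ dens T := by
  unfold dens
  have := Set.ncard_le_ncard h
  gcongr

lemma dens_biUnion_le [Finite α] (t : Finset ι) (S : ι → Set α) :
    dens (⋃ i ∈ t, S i) ≤ ∑ i ∈ t, dens (S i) := by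
  unfold dens
  rw [← Finset.sum_div]
  gcongr
  exact_mod_cast t.set_ncard_biUnion_le S

lemma dens_prod (S : Set α) (T : Set β) : dens (S ×ˢ T) = dens S * dens T := by
  simp only [dens, Set.ncard_prod, Nat.card_prod, Nat.cast_mul]
  rw [mul_div_mul_comm]

lemma dens_preimage_equiv (e : α ≃ β) (S : Set β) : dens (e ⁻¹' S) = dens S := by
  unfold dens
  rw [Nat.card_congr e, Set.ncard_preimage_of_injective_subset_range e.injective (by simp)]

/-- A surjective homomorphism of finite groups is measure preserving. -/
lemma dens_preimage_hom [AddGroup α] [AddGroup β] [Finite α] [Finite β] (f : α →+ β)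
    (hf : Function.Surjective f) (S : Set β) : dens (f ⁻¹' S) = dens S := by
  let e : α ≃ β × f.ker :=
    { toFun := fun a => (f a, ⟨a - (hf (f a)).choose, by
        rw [AddMonoidHom.mem_ker, map_sub, (hf (f a)).choose_spec, sub_self]⟩)
      invFun := fun p => p.2 + (hf p.1).choose
      left_inv := fun a => by simp
      right_inv := fun p => by
        have h : f (p.2 + (hf p.1).choose) = p.1 := by
          rw [map_add, (hf p.1).choose_spec, AddMonoidHom.mem_ker.1 p.2.2, zero_add]
        ext
        · exact h
        · simp [h] }
  have h : f ⁻¹' S = e ⁻¹' (S ×ˢ Set.univ) := by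
    ext a; simp [e]
  rw [h, dens_preimage_equiv, dens_prod]
  have : dens (Set.univ : Set f.ker) = 1 := by
    rw [dens, Set.ncard_univ, div_self (by exact_mod_cast Nat.card_pos.ne')]
  rw [this, mul_one]

end Dens

/-! ### Probability that a uniform matrix has a given rank. -/

section Rank

variable {F : Type*} [Field F] [Fintype F]

/-- A space of dimension `u` has `∏ (q^u - q^i)` ordered bases, and each factor is at least `q^u /
2`. -/
lemma pow_sq_le_card_linearIndependent {V : Type*} [AddCommGroup V] [Module F V] [Finite V] :
    Fintype.card F ^ (Module.finrank F V * Module.finrank F V) ≤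
      2 ^ Module.finrank F V *
        Nat.card {s : Fin (Module.finrank F V) → V // LinearIndependent F s} := by
  rw [card_linearIndependent le_rfl]
  set q := Fintype.card F
  set u := Module.finrank F V
  have h2 : 2 ≤ q := Fintype.one_lt_card
  calc q ^ (u * u) = ∏ i : Fin u, q ^ u := by simp [pow_mul]
    _ ≤ ∏ i : Fin u, 2 * (q ^ u - q ^ i.val) := by
        refine Finset.prod_le_prod' fun i _ => ?_
        have : q * q ^ i.val ≤ q ^ u := by
          rw [← pow_succ']; exact Nat.pow_le_pow_right (by omega) i.2
        have h3 : 2 * q ^ i.val ≤ q * q ^ i.val := Nat.mul_le_mul_right _ h2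
        omega
    _ = _ := by simp [Finset.prod_mul_distrib]

/-- Double count of pairs `(A, T)` with `A` of rank `s` and `T` an ordered basis of its left kernel,
which has dimension `u`. -/
lemma ncard_rank_eq_mul_le {ι κ : Type*} [Fintype ι] [Fintype κ] {s u : ℕ}
    (h : s + u = Fintype.card ι) :
    {A : Matrix ι κ F | A.rank = s}.ncard * Fintype.card F ^ (u * u) ≤
      2 ^ u * (Fintype.card F ^ (Fintype.card ι * u) * Fintype.card F ^ (s * Fintype.card κ)) := by
  classical
  set q := Fintype.card F
  let R : Set (Matrix ι κ F) := {A | A.rank = s}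
  let K : Matrix ι κ F → Submodule F (ι → F) := fun A => LinearMap.ker A.vecMulLinear
  have hK : ∀ A ∈ R, Module.finrank F (K A) = u := by
    intro A hA
    have h1 := LinearMap.finrank_range_add_finrank_ker A.vecMulLinear
    have h2 : Module.finrank F (LinearMap.range A.vecMulLinear) = s := by
      rw [← show A.rank = s from hA, ← Matrix.rank_transpose, Matrix.rank,
        Matrix.mulVecLin_transpose]
    rw [h2, Module.finrank_fintype_fun_eq_card] at h1
    change _ + Module.finrank F (K A) = _ at h1
    omega
  let Ti := {T : Fin u → ι → F // LinearIndependent F T}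
  let Z : Set (Matrix ι κ F × Ti) := {p | p.1 ∈ R ∧ ∀ i, p.2.1 i ∈ K p.1}
  have hlow : R.ncard * q ^ (u * u) ≤ 2 ^ u * Nat.card Z := by
    let e : Z ≃ Σ A : R, {s : Fin u → K A.1 // LinearIndependent F s} :=
      { toFun := fun z => ⟨⟨z.1.1, z.2.1⟩, ⟨fun i => ⟨z.1.2.1 i, z.2.2 i⟩, by
          have := z.1.2.2
          exact LinearIndependent.of_comp (K z.1.1).subtype this⟩⟩
        invFun := fun y => ⟨(y.1.1, ⟨fun i => (y.2.1 i).1,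
          y.2.2.map' (K y.1.1).subtype (Submodule.ker_subtype _)⟩), y.1.2, fun i => (y.2.1 i).2⟩
        left_inv := fun z => rfl
        right_inv := fun y => rfl }
    rw [Nat.card_congr e, Nat.card_sigma, Finset.mul_sum, ← Nat.card_coe_set_eq,
      Nat.card_eq_fintype_card, ← Finset.card_univ, ← smul_eq_mul, ← Finset.sum_const]
    refine Finset.sum_le_sum fun A _ => ?_
    have := pow_sq_le_card_linearIndependent (F := F) (V := K A.1)
    rw [hK A.1 A.2] at this
    exact this
  -- For fixed `T`, each column of `A` lies in the kernel of `T`, a space of dimension `|ι| - u =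
  -- s`.
  have hup : Nat.card Z ≤ q ^ (Fintype.card ι * u) * q ^ (s * Fintype.card κ) := by
    let e : Z → Σ T : Ti, (κ → LinearMap.ker (Matrix.mulVecLin (Matrix.of T.1))) :=
      fun z => ⟨z.1.2, fun j => ⟨fun i => z.1.1 i j, by
        rw [LinearMap.mem_ker]
        ext i
        have := congrFun (LinearMap.mem_ker.1 (z.2.2 i)) j
        simpa [Matrix.mulVec, Matrix.vecMul, dotProduct] using this⟩⟩
    have he : Function.Injective e := by
      rintro ⟨⟨A, T⟩, hz⟩ ⟨⟨A', T'⟩, hz'⟩ hh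
      simp only [e, Sigma.mk.injEq] at hh
      obtain ⟨rfl, h2⟩ := hh
      have h3 := eq_of_heq h2
      have : A = A' := by
        ext i j
        exact congrFun (congrArg Subtype.val (congrFun h3 j)) i
      subst this
      rfl
    refine (Nat.card_le_card_of_injective e he).trans ?_
    rw [Nat.card_sigma]
    have hT : ∀ T : Ti, Nat.card (κ → LinearMap.ker (Matrix.mulVecLin (Matrix.of T.1))) =
        q ^ (s * Fintype.card κ) := by
      intro T
      have h1 := LinearMap.finrank_range_add_finrank_ker (Matrix.mulVecLin (Matrix.of T.1))
      have h2 : Module.finrank F (LinearMap.range (Matrix.mulVecLin (Matrix.of T.1))) = u := by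
        have := T.2.rank_matrix (M := Matrix.of T.1)
        simpa [Matrix.rank] using this
      rw [h2, Module.finrank_fintype_fun_eq_card] at h1
      rw [Nat.card_fun, Nat.card_eq_fintype_card, Nat.card_eq_fintype_card,
        Module.card_eq_pow_finrank (K := F), ← pow_mul]
      congr 2
      omega
    rw [Finset.sum_congr rfl fun T _ => hT T, Finset.sum_const, smul_eq_mul]
    gcongr
    refine (Fintype.card_subtype_le _).trans ?_
    simp [← pow_mul, q]
  calc R.ncard * q ^ (u * u) ≤ 2 ^ u * Nat.card Z := hlow
    _ ≤ _ := by gcongr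

lemma dens_rank_eq_le {ι κ : Type*} [Fintype ι] [Fintype κ] {s u d : ℕ}
    (h : s + u = Fintype.card ι) (h' : s + d = Fintype.card κ) :
    dens {A : Matrix ι κ F | A.rank = s} ≤ 2 ^ u * ((Fintype.card F : ℝ)⁻¹) ^ (u * d) := by
  classical
  have hq : (0 : ℝ) < Fintype.card F := by exact_mod_cast Fintype.card_pos
  have hc : Nat.card (Matrix ι κ F) = Fintype.card F ^ (Fintype.card ι * Fintype.card κ) := by
    change Nat.card (ι → κ → F) = _
    rw [Nat.card_eq_fintype_card, Fintype.card_fun, Fintype.card_fun, ← pow_mul, mul_comm]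
  have key := ncard_rank_eq_mul_le (F := F) (κ := κ) h
  rw [dens, hc, inv_pow, ← div_eq_mul_inv, div_le_div_iff₀ (by positivity) (by positivity)]
  norm_cast
  refine Nat.le_of_mul_le_mul_right (c := Fintype.card F ^ (u * u)) ?_ (by positivity)
  calc _ = ({A : Matrix ι κ F | A.rank = s}.ncard * Fintype.card F ^ (u * u)) *
        Fintype.card F ^ (u * d) := by ring
    _ ≤ _ := Nat.mul_le_mul_right _ key
    _ = _ := by rw [← h, ← h']; ring

lemma dens_rank_eq_le' {ι κ : Type*} [Fintype ι] [Fintype κ] {s u d : ℕ}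
    (h : s + u = Fintype.card ι) (h' : s + d = Fintype.card κ) :
    dens {A : Matrix ι κ F | A.rank = s} ≤ 2 ^ d * ((Fintype.card F : ℝ)⁻¹) ^ (u * d) := by
  have := dens_rank_eq_le (F := F) h' h
  rw [mul_comm u d]
  refine le_of_eq_of_le ?_ this
  rw [← dens_preimage_equiv (Equiv.mk Matrix.transpose Matrix.transpose
    (fun A => Matrix.transpose_transpose A) (fun A => Matrix.transpose_transpose A) :
    Matrix ι κ F ≃ Matrix κ ι F)]
  congr 1
  ext A
  simp [Matrix.rank_transpose]

end Rank

/-! ### Vertical separations in terms of column ranks. -/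

section MatroidRank

variable {F : Type*} [Field F]

/-- The rank of the set of columns of `A` indexed by `X`. -/
noncomputable def colRank {ι κ : Type*} (A : Matrix ι κ F) (X : Set κ) : ℕ :=
  Module.finrank F (Submodule.span F (A.col '' X))

lemma representedMatroid_indep_iff {ι κ : Type*} [Finite κ] (A : Matrix ι κ F) (I : Set κ) :
    (representedMatroid A).Indep I ↔ LinearIndepOn F A.col I := by
  simp [representedMatroid]

lemma representedMatroid_ground {ι κ : Type*} [Finite κ] (A : Matrix ι κ F) :
    (representedMatroid A).E = Set.univ := by
  simp [representedMatroid]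

lemma colRank_eq_ncard {ι κ : Type*} [Finite κ] {A : Matrix ι κ F} {I : Set κ}
    (hI : LinearIndepOn F A.col I) : colRank A I = I.ncard := by
  have := Fintype.ofFinite I
  rw [colRank, Set.image_eq_range, finrank_span_eq_card hI, Set.ncard_eq_toFinset_card',
    Set.toFinset_card]

lemma colRank_le_ncard {ι κ : Type*} [Finite κ] (A : Matrix ι κ F) (X : Set κ) :
    colRank A X ≤ X.ncard := by
  have := Fintype.ofFinite X
  rw [colRank, Set.image_eq_range, ← Nat.card_coe_set_eq, Nat.card_eq_fintype_card]
  exact finrank_range_le_card _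

lemma colRank_mono {ι κ : Type*} [Finite κ] (A : Matrix ι κ F) {X Y : Set κ} (h : X ⊆ Y) :
    colRank A X ≤ colRank A Y := by
  have : Module.Finite F (Submodule.span F (A.col '' Y)) :=
    Module.Finite.span_of_finite F (Set.toFinite _)
  exact Submodule.finrank_mono (Submodule.span_mono (Set.image_mono h))

lemma colRank_eq_rank_submatrix {ι κ : Type*} [Fintype κ] (A : Matrix ι κ F) (X : Set κ)
    [Fintype X] : colRank A X = (A.submatrix id ((↑) : X → κ)).rank := by
  rw [colRank, Matrix.rank_eq_finrank_span_cols, Set.image_eq_range]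
  rfl

lemma colRank_univ {ι κ : Type*} [Fintype κ] (A : Matrix ι κ F) :
    colRank A Set.univ = A.rank := by
  rw [colRank, Matrix.rank_eq_finrank_span_cols, Set.image_univ]

lemma rank_le_colRank_add {ι κ : Type*} [Fintype κ] (A : Matrix ι κ F) (X : Set κ) :
    A.rank ≤ colRank A X + colRank A Xᶜ := by
  rw [← colRank_univ, ← Set.union_compl_self X, colRank, Set.image_union, Submodule.span_union]
  have h1 : Module.Finite F (Submodule.span F (A.col '' X)) :=
    Module.Finite.span_of_finite F (Set.toFinite _)
  have h2 : Module.Finite F (Submodule.span F (A.col '' Xᶜ)) :=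
    Module.Finite.span_of_finite F (Set.toFinite _)
  exact Submodule.finrank_add_le_finrank_add_finrank _ _

/-- By maximality, a matroid basis of `X` spans every column indexed by `X`. -/
lemma eRk_representedMatroid {ι κ : Type*} [Finite κ] (A : Matrix ι κ F) (X : Set κ) :
    (representedMatroid A).eRk X = colRank A X := by
  obtain ⟨I, hI⟩ := (representedMatroid A).exists_isBasis' X
  have hind := (representedMatroid_indep_iff A I).1 hI.indep
  rw [hI.eRk_eq_encard, ← (Set.toFinite I).cast_ncard_eq, ← colRank_eq_ncard hind]
  have hspan : Submodule.span F (A.col '' I) = Submodule.span F (A.col '' X) := by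
    refine le_antisymm (Submodule.span_mono (Set.image_mono hI.subset)) (Submodule.span_le.2 ?_)
    rintro _ ⟨e, he, rfl⟩
    by_cases heI : e ∈ I
    · exact Submodule.subset_span ⟨e, heI, rfl⟩
    · by_contra hns
      have h1 : (representedMatroid A).Indep (insert e I) :=
        (representedMatroid_indep_iff A _).2 (hind.insert hns)
      exact heI (hI.mem_of_insert_indep he h1)
  rw [colRank, hspan, colRank]

lemma eRank_representedMatroid {ι κ : Type*} [Fintype κ] (A : Matrix ι κ F) :
    (representedMatroid A).eRank = A.rank := by
  rw [← colRank_univ, ← eRk_representedMatroid, ← representedMatroid_ground A,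
    Matroid.eRk_ground]

lemma isVerticallyConnected_iff {κ : Type*} (M : Matroid κ) (k : ℕ) :
    IsVerticallyConnected M k ↔ ∀ l < k, ∀ X Y, ¬ IsVerticalSeparation M l X Y := by
  simp only [IsVerticallyConnected, verticalConnectivity, le_iInf_iff, Nat.cast_le,
    forall_exists_index]
  constructor
  · intro h l hl X Y hs
    exact absurd (h l X Y hs) (by omega)
  · intro h l X Y hs
    by_contra hl
    exact h l (by omega) X Y hs

lemma isVerticalSeparation_iff {ι κ : Type*} [Fintype κ] (A : Matrix ι κ F) (l : ℕ)
    (X Y : Set κ) : IsVerticalSeparation (representedMatroid A) l X Y ↔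
      Y = Xᶜ ∧ l ≤ colRank A X ∧ l ≤ colRank A Xᶜ ∧
        colRank A X + colRank A Xᶜ + 1 ≤ A.rank + l := by
  have hc : (X ∪ Y = Set.univ ∧ Disjoint X Y) ↔ Y = Xᶜ := by
    rw [eq_comm (a := Y), compl_eq_iff_isCompl, isCompl_iff, codisjoint_iff]
    tauto
  rw [IsVerticalSeparation, representedMatroid_ground, ← and_assoc, hc]
  refine and_congr_right ?_
  rintro rfl
  rw [eRk_representedMatroid, eRk_representedMatroid, eRank_representedMatroid, le_min_iff,
    and_assoc]
  norm_cast

/-- Two nonspanning sets partitioning the columns, one of them small, witness that the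
represented matroid is not vertically connected. -/
lemma not_isVerticallyConnected {ι κ : Type*} [Fintype κ] {A : Matrix ι κ F} {k : ℕ} {X : Set κ}
    (hk : X.ncard < k) (hX : X.ncard < A.rank) (hY : colRank A Xᶜ < A.rank) :
    ¬ IsVerticallyConnected (representedMatroid A) k := by
  rw [isVerticallyConnected_iff]
  push Not
  have := colRank_le_ncard A X
  refine ⟨min (colRank A X) (colRank A Xᶜ), by omega, X, Xᶜ, ?_⟩
  rw [isVerticalSeparation_iff]
  exact ⟨rfl, by omega, by omega, by omega⟩

/-- The order of the separation is eliminated, and symmetry lets `X` be the side of smaller rank;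
this is the form the union bound runs over. -/
lemma exists_of_not_isVerticallyConnected {ι κ : Type*} [Fintype κ] {A : Matrix ι κ F} {k : ℕ}
    (h : ¬ IsVerticallyConnected (representedMatroid A) k) :
    ∃ X : Set κ, colRank A X ≤ colRank A Xᶜ ∧ colRank A Xᶜ < A.rank ∧
      colRank A X + colRank A Xᶜ + 2 ≤ A.rank + k := by
  rw [isVerticallyConnected_iff] at h
  push Not at h
  obtain ⟨l, hl, X, Y, hs⟩ := h
  rw [isVerticalSeparation_iff] at hs
  obtain ⟨-, h1, h2, h3⟩ := hs
  rcases le_total (colRank A X) (colRank A Xᶜ) with h | h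
  · exact ⟨X, h, by omega, by omega⟩
  · exact ⟨Xᶜ, by rwa [compl_compl], by rw [compl_compl]; omega, by rw [compl_compl]; omega⟩

lemma rank_eq_of_vecMul_ne_zero {ι κ : Type*} [Fintype ι] [Fintype κ] {A : Matrix ι κ F}
    (h : ∀ y, y ≠ 0 → Matrix.vecMul y A ≠ 0) : A.rank = Fintype.card ι := by
  have hinj : Function.Injective A.vecMulLinear := by
    rw [← LinearMap.ker_eq_bot, LinearMap.ker_eq_bot']
    intro y hy
    by_contra hne
    exact h y hne hy
  rw [← Matrix.rank_transpose, Matrix.rank, Matrix.mulVecLin_transpose,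
    LinearMap.finrank_range_of_inj hinj, Module.finrank_fintype_fun_eq_card]

/-- These columns all lie in the hyperplane orthogonal to `y`. -/
lemma colRank_lt_of_vecMul_eq_zero {ι κ : Type*} [Fintype ι] {A : Matrix ι κ F}
    {y : ι → F} (hy : y ≠ 0) {Y : Set κ} (h : ∀ j ∈ Y, Matrix.vecMul y A j = 0) :
    colRank A Y < Fintype.card ι := by
  classical
  let f : (ι → F) →ₗ[F] F := Fintype.linearCombination F y
  have hf : ∀ x, f x = ∑ i, x i * y i := fun x => by simp [f, Fintype.linearCombination_apply]
  have hle : Submodule.span F (A.col '' Y) ≤ LinearMap.ker f := by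
    rw [Submodule.span_le]
    rintro _ ⟨j, hj, rfl⟩
    have := h j hj
    rw [SetLike.mem_coe, LinearMap.mem_ker, hf, ← this, Matrix.vecMul, dotProduct]
    exact Finset.sum_congr rfl fun i _ => mul_comm _ _
  refine (Submodule.finrank_mono hle).trans_lt ?_
  rw [← Module.finrank_fintype_fun_eq_card F (η := ι)]
  refine Submodule.finrank_lt fun htop => hy ?_
  ext i
  have : f (Pi.single i 1) = 0 := by rw [← LinearMap.mem_ker, htop]; trivial
  rw [hf] at this
  simpa [Pi.single_apply] using this

/-- Rules out all times up to `m` from three events at fixed times: `n - w` independent columns,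
full rank at `n + w`, and a light row-space word at `m`. -/
lemma not_isVerticallyConnected_columnMatrix {n k m m' w : ℕ} {v : ℕ → Fin n → F}
    (hw : 2 * w + 1 < k) (hwn : 3 * w + 1 < n) (hk : k ≤ n)
    (h1 : ∀ x, x ≠ 0 → (columnMatrix v (n - w)).mulVec x ≠ 0)
    (h2 : ∀ y, y ≠ 0 → Matrix.vecMul y (columnMatrix v (n + w)) ≠ 0)
    (h3 : ∃ y, y ≠ 0 ∧ {j | Matrix.vecMul y (columnMatrix v m) j ≠ 0}.ncard < k)
    (hm2 : 2 ≤ m') (hm' : m' ≤ m) :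
    ¬ IsVerticallyConnected (representedMatroid (columnMatrix v m')) k := by
  rcases le_or_gt m' (n + w) with hle | hgt
  · set p := min m' (n - w) with hp
    have hlin : LinearIndependent F (columnMatrix v (n - w)).col := by
      rw [← Matrix.mulVec_injective_iff, ← Matrix.coe_mulVecLin, ← LinearMap.ker_eq_bot,
        LinearMap.ker_eq_bot']
      intro x hx
      by_contra hne
      exact h1 x hne hx
    let I : Set (Fin m') := {i | i.1 < p}
    have hIfin : I.ncard = p := by
      have : I = Set.range (Fin.castLE (min_le_left m' (n - w))) := by
        ext i
        simp only [I, Set.mem_ofPred_eq, Set.mem_range]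
        exact ⟨fun h => ⟨⟨i, h⟩, rfl⟩, by rintro ⟨j, rfl⟩; exact j.2⟩
      rw [this, ← Nat.card_coe_set_eq, Nat.card_range_of_injective (Fin.castLE_injective _),
        Nat.card_eq_fintype_card, Fintype.card_fin]
    have hI : LinearIndepOn F (columnMatrix v m').col I := by
      have : LinearIndependent F fun i : I =>
          (columnMatrix v (n - w)).col ⟨i.1, lt_of_lt_of_le i.2 (min_le_right _ _)⟩ :=
        hlin.comp _ fun i j h => by
          ext; simpa using h
      exact this
    have hrank : p ≤ (columnMatrix v m').rank := by
      rw [← colRank_univ, ← hIfin, ← colRank_eq_ncard hI]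
      exact colRank_mono _ (Set.subset_univ _)
    -- Removing one column from the `p` independent ones leaves `Y` of rank below `p`, hence
    -- nonspanning, while its complement has at most `2w + 1 < k` elements. If `m' ≤ n - w` that
    -- complement is a single column, which is nonspanning because `m' ≥ 2`; otherwise `3w + 1 < n`
    -- does it.
    let z : Fin m' := ⟨0, by omega⟩
    let Y : Set (Fin m') := I \ {z}
    have hz : z ∈ I := show 0 < p by omega
    have hY : Y.ncard = p - 1 := by rw [Set.ncard_sdiff_singleton_of_mem hz, hIfin]
    have hX : Yᶜ.ncard = m' - (p - 1) := by
      rw [Set.ncard_compl, hY, Nat.card_eq_fintype_card, Fintype.card_fin]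
    refine not_isVerticallyConnected (X := Yᶜ) (by omega) (by omega) ?_
    rw [compl_compl]
    have := colRank_le_ncard (columnMatrix v m') Y
    omega
  · have hrank : (columnMatrix v m').rank = n := by
      conv_rhs => rw [← Fintype.card_fin n]
      refine rank_eq_of_vecMul_ne_zero fun y hy h0 => h2 y hy ?_
      ext j
      exact congrFun h0 ⟨j, by omega⟩
    obtain ⟨y, hy, hcard⟩ := h3
    -- The support of the word truncated to the first `m'` coordinates; truncation cannot increase
    -- weight.
    let X : Set (Fin m') := {j | Matrix.vecMul y (columnMatrix v m') j ≠ 0}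
    have hX : X.ncard < k := by
      refine lt_of_le_of_lt ?_ hcard
      refine Set.ncard_le_ncard_of_injOn (Fin.castLE hm') ?_ (Fin.castLE_injective _).injOn
      intro j hj
      exact hj
    refine not_isVerticallyConnected (X := X) hX (by omega) ?_
    rw [hrank]
    have := colRank_lt_of_vecMul_eq_zero (A := columnMatrix v m') hy (Y := Xᶜ) (by
      intro j hj
      simpa [X] using hj)
    simpa using this

lemma connTime_le {n m k : ℕ} {v : ℕ → Fin n → F} (hm : 2 ≤ m)
    (h : IsVerticallyConnected (representedMatroid (columnMatrix v m)) k) :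
    connTime v k ≤ m :=
  iInf₂_le m ⟨hm, h⟩

lemma lt_connTime {n m k : ℕ} {v : ℕ → Fin n → F}
    (h : ∀ m', 2 ≤ m' → m' ≤ m →
      ¬ IsVerticallyConnected (representedMatroid (columnMatrix v m')) k) :
    (m + 1 : ℕ) ≤ connTime v k := by
  refine le_iInf₂ fun m' hm' => ?_
  by_contra hlt
  push Not at hlt
  have : m' < m + 1 := by exact_mod_cast hlt
  exact h m' hm'.1 (by omega) hm'.2

end MatroidRank

/-! ### From the random columns to counting matrices. -/

section Law

variable {F : Type*} [Field F] [Fintype F] [MeasurableSpace F] [DiscreteMeasurableSpace F]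

lemma measure_columnMatrix_mem {Ω : Type*} [MeasurableSpace Ω] {P : Measure Ω}
    [IsProbabilityMeasure P] {n : ℕ} {v : ℕ → Ω → Fin n → F}
    (hv : IsUniformColumnSequence P v) (m : ℕ) (S : Set (Matrix (Fin n) (Fin m) F)) :
    P {ω | columnMatrix (fun i => v i ω) m ∈ S} = ENNReal.ofReal (dens S) := by
  classical
  let g : Ω → Fin m → Fin n → F := fun ω i => v i ω
  have hg : Measurable g := measurable_pi_lambda _ fun i => hv.measurable i
  let e : (Fin m → Fin n → F) ≃ Matrix (Fin n) (Fin m) F :=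
    Equiv.piComm (fun _ _ => F)
  let T : Set (Fin m → Fin n → F) := e ⁻¹' S
  have hlaw : P.map g = Measure.pi fun i : Fin m => P.map (v i) :=
    (hv.indep.precomp Fin.val_injective).map_fun_eq_pi_map
      fun i => (hv.measurable i).aemeasurable
  have hprob : ∀ i, IsProbabilityMeasure (P.map (v i)) := fun i =>
    Measure.isProbabilityMeasure_map (hv.measurable i).aemeasurable
  have hN : Nat.card (Matrix (Fin n) (Fin m) F) = Fintype.card (Fin n → F) ^ m := by
    rw [← Nat.card_congr e, Nat.card_eq_fintype_card, Fintype.card_fun, Fintype.card_fin]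
  have hsing : ∀ a, P.map g {a} = (Nat.card (Matrix (Fin n) (Fin m) F) : ENNReal)⁻¹ := by
    intro a
    rw [hlaw, Measure.pi_singleton]
    simp only [hv.uniform, uniformOn_univ, Measure.count_singleton]
    rw [hN, Finset.prod_const, Finset.card_univ, Fintype.card_fin, one_div, Nat.cast_pow,
      ENNReal.inv_pow]
  have hset : {ω | columnMatrix (fun i => v i ω) m ∈ S} = g ⁻¹' T := rfl
  rw [hset, ← Measure.map_apply hg (MeasurableSet.of_discrete),
    ← (Set.toFinite T).coe_toFinset, ← sum_measure_singleton]
  simp only [hsing, Finset.sum_const, nsmul_eq_mul]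
  rw [← dens_preimage_equiv e S, dens, ← Set.ncard_eq_toFinset_card, Nat.card_congr e,
    ENNReal.ofReal_div_of_pos (by rw [hN]; have := Fintype.card_pos (α := Fin n → F); positivity),
    ENNReal.ofReal_natCast, ENNReal.ofReal_natCast, ENNReal.div_eq_inv_mul, mul_comm]

end Law

/-! ### The second moment method. -/

section SecondMoment

/-- Chebyshev for the number of events `S y` that occur, with mean `μ = |Y| b`. Only pairs with `y'
∈ R y` can be correlated, so the variance is at most `r μ`, and the count misses its mean by `μ`
when it vanishes. -/
lemma dens_compl_iUnion_le {α ι : Type*} [Finite α] [Nonempty α] [DecidableEq ι] (Y : Finset ι)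
    (S : ι → Set α) (R : ι → Finset ι) {b : ℝ} {r : ℕ} (hb : 0 < b) (hY : Y.Nonempty)
    (hS : ∀ y ∈ Y, dens (S y) = b) (hR : ∀ y ∈ Y, (R y).card ≤ r)
    (hSR : ∀ y ∈ Y, ∀ y' ∈ Y, y' ∉ R y → dens (S y ∩ S y') = b ^ 2) :
    dens {a | ∀ y ∈ Y, a ∉ S y} ≤ r / (Y.card * b) := by
  classical
  have := Fintype.ofFinite α
  set N : ℝ := (Nat.card α : ℝ) with hN
  have hNpos : 0 < N := by rw [hN]; exact_mod_cast Nat.card_pos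
  have hYpos : (0 : ℝ) < Y.card := by exact_mod_cast hY.card_pos
  let X : ι → α → ℝ := fun y => (S y).indicator 1
  have hX : ∀ y a, X y a = if a ∈ S y then 1 else 0 := fun y a => by
    simp [X, Set.indicator_apply]
  have hsum : ∀ T : Set α, ∑ a, (if a ∈ T then (1 : ℝ) else 0) = dens T * N := by
    intro T
    rw [dens, div_mul_cancel₀ _ hNpos.ne', Finset.sum_boole, Set.ncard_eq_toFinset_card']
    congr 2
    ext a; simp
  set Z : Set α := {a | ∀ y ∈ Y, a ∉ S y} with hZ
  set μ : ℝ := Y.card * b with hμ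
  have hμpos : 0 < μ := by positivity
  have h1 : ∑ a, ∑ y ∈ Y, X y a = μ * N := by
    rw [Finset.sum_comm]
    simp only [hX, hsum]
    rw [Finset.sum_congr rfl fun y hy => by rw [hS y hy], Finset.sum_const, nsmul_eq_mul, hμ]
    ring
  have h2 : ∑ a, (∑ y ∈ Y, X y a) ^ 2 ≤ (μ ^ 2 + r * μ) * N := by
    have : ∀ a, (∑ y ∈ Y, X y a) ^ 2 =
        ∑ y ∈ Y, ∑ y' ∈ Y, if a ∈ S y ∩ S y' then (1 : ℝ) else 0 := by
      intro a
      rw [sq, Finset.sum_mul_sum]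
      refine Finset.sum_congr rfl fun y _ => Finset.sum_congr rfl fun y' _ => ?_
      simp only [hX, Set.mem_inter_iff, ite_and]
      split_ifs <;> simp
    simp only [this]
    rw [Finset.sum_comm]
    have h3 : ∀ y ∈ Y, ∑ a, ∑ y' ∈ Y, (if a ∈ S y ∩ S y' then (1 : ℝ) else 0) ≤
        (Y.card * b ^ 2 + r * b) * N := by
      intro y hy
      rw [Finset.sum_comm]
      have hs2 : ∀ y', ∑ a, (if a ∈ S y ∩ S y' then (1 : ℝ) else 0) = dens (S y ∩ S y') * N :=
        fun y' => by convert hsum (S y ∩ S y')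
      simp only [hs2]
      rw [← Finset.sum_mul]
      gcongr
      calc ∑ y' ∈ Y, dens (S y ∩ S y') ≤ ∑ y' ∈ Y, (b ^ 2 + if y' ∈ R y then b else 0) := by
            refine Finset.sum_le_sum fun y' hy' => ?_
            split_ifs with h
            · have := dens_mono (Set.inter_subset_left : S y ∩ S y' ⊆ S y)
              rw [hS y hy] at this
              nlinarith
            · rw [hSR y hy y' hy' h, add_zero]
        _ = Y.card * b ^ 2 + ((Y.filter (· ∈ R y)).card : ℝ) * b := by
            rw [Finset.sum_add_distrib, Finset.sum_const, nsmul_eq_mul, ← Finset.sum_filter,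
              Finset.sum_const, nsmul_eq_mul]
        _ ≤ _ := by
            gcongr
            exact (Finset.card_le_card fun z hz => (Finset.mem_filter.1 hz).2).trans (hR y hy)
    refine (Finset.sum_le_sum h3).trans (le_of_eq ?_)
    rw [Finset.sum_const, nsmul_eq_mul, hμ]
    ring
  have h3 : dens Z * N * μ ^ 2 ≤ ∑ a, (∑ y ∈ Y, X y a - μ) ^ 2 := by
    rw [← hsum, Finset.sum_mul]
    refine Finset.sum_le_sum fun a _ => ?_
    split_ifs with h
    · rw [Finset.sum_eq_zero fun y hy => by rw [hX, if_neg (h y hy)]]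
      simp
    · rw [zero_mul]; positivity
  have h4 : ∑ a, (∑ y ∈ Y, X y a - μ) ^ 2 =
      ∑ a, (∑ y ∈ Y, X y a) ^ 2 - 2 * μ * ∑ a, ∑ y ∈ Y, X y a + N * μ ^ 2 := by
    have hc : N * μ ^ 2 = ∑ _a : α, μ ^ 2 := by
      rw [Finset.sum_const, nsmul_eq_mul, hN, Nat.card_eq_fintype_card, Finset.card_univ]
    rw [hc, Finset.mul_sum, ← Finset.sum_sub_distrib, ← Finset.sum_add_distrib]
    exact Finset.sum_congr rfl fun a _ => by ring
  rw [le_div_iff₀ hμpos]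
  have h5 : dens Z * μ * (N * μ) ≤ r * (N * μ) := by
    rw [h4, h1] at h3
    nlinarith
  exact le_of_mul_le_mul_right h5 (by positivity)

end SecondMoment

/-! ### Words in the row space of a uniform matrix. -/

section Uniform

variable {F : Type*} [Field F] [Fintype F]

/-- A matrix `T` with independent rows has a right inverse, so `A ↦ T * A` is a surjective
homomorphism. One row gives uniformity of `yA`, two rows give pairwise independence. -/
lemma dens_mul_mem {τ ι κ : Type*} [Fintype τ] [Fintype ι] [Finite κ]
    {T : Matrix τ ι F} (hT : LinearIndependent F T.row) (B : Set (Matrix τ κ F)) :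
    dens {A : Matrix ι κ F | T * A ∈ B} = dens B := by
  classical
  have hsurj : Function.Surjective T.mulVec := by
    rw [← Matrix.coe_mulVecLin, ← LinearMap.range_eq_top]
    apply Submodule.eq_top_of_finrank_eq
    rw [Module.finrank_fintype_fun_eq_card]
    exact hT.rank_matrix
  obtain ⟨D, hD⟩ := Matrix.mulVec_surjective_iff_exists_right_inverse.1 hsurj
  refine dens_preimage_hom (AddMonoidHom.mk' (fun A : Matrix ι κ F => T * A)
    fun A A' => Matrix.mul_add T A A') (fun C => ⟨D * C, ?_⟩) B
  rw [AddMonoidHom.mk'_apply, ← Matrix.mul_assoc, hD, Matrix.one_mul]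

lemma dens_vecMul_mem {ι κ : Type*} [Fintype ι] [Finite κ] {y : ι → F} (hy : y ≠ 0)
    (B : Set (κ → F)) : dens {A : Matrix ι κ F | Matrix.vecMul y A ∈ B} = dens B := by
  have := dens_mul_mem (κ := κ) (T := Matrix.of fun _ : Unit => y)
    (linearIndependent_unique_iff.2 hy) {C | C () ∈ B}
  refine Eq.trans ?_ (this.trans ?_)
  · rfl
  · exact dens_preimage_equiv (Equiv.funUnique Unit (κ → F)) B

lemma dens_vecMul_mem_inter {ι κ : Type*} [Fintype ι] [Finite κ] {y y' : ι → F}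
    (h : LinearIndependent F ![y, y']) (B : Set (κ → F)) :
    dens ({A : Matrix ι κ F | Matrix.vecMul y A ∈ B} ∩ {A | Matrix.vecMul y' A ∈ B}) =
      dens B ^ 2 := by
  have := dens_mul_mem (κ := κ) (T := Matrix.of ![y, y']) h {C | C 0 ∈ B ∧ C 1 ∈ B}
  refine Eq.trans ?_ (this.trans ?_)
  · rfl
  · rw [sq, ← dens_prod]
    exact dens_preimage_equiv (finTwoArrowEquiv (κ → F)) (B ×ˢ B)

lemma dens_singleton_zero {κ : Type*} [Fintype κ] :
    dens ({0} : Set (κ → F)) = ((Fintype.card F : ℝ)⁻¹) ^ Fintype.card κ := by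
  classical
  rw [dens, Set.ncard_singleton, Nat.card_eq_fintype_card, Fintype.card_fun]
  simp

lemma dens_exists_vecMul_eq_zero_le {ι κ : Type*} [Fintype ι] [Fintype κ] :
    dens {A : Matrix ι κ F | ∃ y, y ≠ 0 ∧ Matrix.vecMul y A = 0} ≤
      (Fintype.card F : ℝ) ^ Fintype.card ι * ((Fintype.card F : ℝ)⁻¹) ^ Fintype.card κ := by
  classical
  have h : {A : Matrix ι κ F | ∃ y, y ≠ 0 ∧ Matrix.vecMul y A = 0} ⊆
      ⋃ y ∈ Finset.univ.erase (0 : ι → F), {A | Matrix.vecMul y A ∈ ({0} : Set (κ → F))} := by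
    rintro A ⟨y, hy, h0⟩
    simp only [Set.mem_iUnion]
    exact ⟨y, by simpa using hy, h0⟩
  refine (dens_mono h).trans ((dens_biUnion_le _ _).trans ?_)
  rw [Finset.sum_congr rfl fun y hy => by
    rw [dens_vecMul_mem (Finset.ne_of_mem_erase hy), dens_singleton_zero],
    Finset.sum_const, nsmul_eq_mul]
  gcongr
  have : (Finset.univ.erase (0 : ι → F)).card ≤ Fintype.card F ^ Fintype.card ι := by
    refine (Finset.card_le_univ _).trans ?_
    rw [Fintype.card_fun]
  exact_mod_cast this

lemma dens_exists_mulVec_eq_zero_le {ι κ : Type*} [Fintype ι] [Fintype κ] :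
    dens {A : Matrix ι κ F | ∃ x, x ≠ 0 ∧ A.mulVec x = 0} ≤
      (Fintype.card F : ℝ) ^ Fintype.card κ * ((Fintype.card F : ℝ)⁻¹) ^ Fintype.card ι := by
  refine le_of_eq_of_le ?_ (dens_exists_vecMul_eq_zero_le (F := F) (ι := κ) (κ := ι))
  rw [← dens_preimage_equiv (Equiv.mk Matrix.transpose Matrix.transpose
    (fun A => Matrix.transpose_transpose A) (fun A => Matrix.transpose_transpose A) :
    Matrix ι κ F ≃ Matrix κ ι F)]
  congr 1
  ext A
  simp [Matrix.vecMul_transpose]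

/-- The vectors with fewer than `k` nonzero entries. -/
def lowWeight (F : Type*) [Field F] (m k : ℕ) : Set (Fin m → F) := {c | {j | c j ≠ 0}.ncard < k}

/-- Choose a support of size `j` and a unit at each of its points. -/
lemma choose_mul_pow_le_ncard_lowWeight {m j k : ℕ} (hj : j < k) :
    m.choose j * (Fintype.card F - 1) ^ j ≤ (lowWeight F m k).ncard := by
  classical
  let D := Σ s : Finset.powersetCard j (Finset.univ : Finset (Fin m)), (s.1 → Fˣ)
  let f : D → lowWeight F m k := fun p =>
    ⟨fun i => if h : i ∈ p.1.1 then (p.2 ⟨i, h⟩ : F) else 0, by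
      have hs := (Finset.mem_powersetCard.1 p.1.2).2
      have : {i | (if h : i ∈ p.1.1 then (p.2 ⟨i, h⟩ : F) else 0) ≠ 0} ⊆ (p.1.1 : Set (Fin m)) := by
        intro i hi
        by_contra hn
        exact hi (dif_neg hn)
      refine (Set.ncard_le_ncard this).trans_lt ?_
      rw [Set.ncard_coe_finset, hs]
      exact hj⟩
  have hf : Function.Injective f := by
    rintro ⟨⟨s, hs⟩, a⟩ ⟨⟨s', hs'⟩, a'⟩ h
    have h0 : ∀ i, (if h : i ∈ s then (a ⟨i, h⟩ : F) else 0) =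
        if h : i ∈ s' then (a' ⟨i, h⟩ : F) else 0 := fun i =>
      congrFun (congrArg Subtype.val h) i
    have hss : s = s' := by
      ext i
      have := h0 i
      by_cases h1 : i ∈ s <;> by_cases h2 : i ∈ s'
      · exact iff_of_true h1 h2
      · rw [dif_pos h1, dif_neg h2] at this
        exact absurd this (Units.ne_zero _)
      · rw [dif_neg h1, dif_pos h2] at this
        exact absurd this.symm (Units.ne_zero _)
      · exact iff_of_false h1 h2
    subst hss
    have : a = a' := by
      ext ⟨i, hi⟩
      simpa [hi] using h0 i
    rw [this]
  have hcard := Nat.card_le_card_of_injective f hf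
  rw [Nat.card_coe_set_eq] at hcard
  refine le_of_eq_of_le ?_ hcard
  rw [Nat.card_sigma]
  have : ∀ s : Finset.powersetCard j (Finset.univ : Finset (Fin m)),
      Nat.card (s.1 → Fˣ) = (Fintype.card F - 1) ^ j := by
    intro s
    rw [Nat.card_eq_fintype_card, Fintype.card_fun, Fintype.card_units, Fintype.card_coe,
      (Finset.mem_powersetCard.1 s.2).2]
  rw [Finset.sum_congr rfl fun s _ => this s, Finset.sum_const, Finset.card_univ, Fintype.card_coe,
    Finset.card_powersetCard, Finset.card_univ, Fintype.card_fin, smul_eq_mul]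

lemma dens_forall_vecMul_notMem_le {ι κ : Type*} [Fintype ι] [Nonempty ι] [Finite κ]
    (B : Set (κ → F)) (hB : B.Nonempty) :
    dens {A : Matrix ι κ F | ∀ y, y ≠ 0 → Matrix.vecMul y A ∉ B} ≤
      Fintype.card F / (((Fintype.card F : ℝ) ^ Fintype.card ι - 1) * dens B) := by
  classical
  have hcard : ((Finset.univ.erase (0 : ι → F)).card : ℝ) =
      (Fintype.card F : ℝ) ^ Fintype.card ι - 1 := by
    rw [Finset.card_erase_of_mem (Finset.mem_univ _), Finset.card_univ, Fintype.card_fun,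
      Nat.cast_sub (Nat.one_le_pow _ _ Fintype.card_pos)]
    simp
  have hb : 0 < dens B := by
    have h1 : 0 < B.ncard := (Set.ncard_pos).2 hB
    have h2 : 0 < Nat.card (κ → F) := Nat.card_pos
    unfold dens
    positivity
  rw [← hcard]
  have hset : {A : Matrix ι κ F | ∀ y, y ≠ 0 → Matrix.vecMul y A ∉ B} =
      {A | ∀ y ∈ Finset.univ.erase (0 : ι → F), A ∉ {A : Matrix ι κ F | Matrix.vecMul y A ∈ B}} := by
    ext A; simp
  rw [hset]
  -- The vectors dependent on `y` are its `q` scalar multiples.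
  refine dens_compl_iUnion_le _ _ (fun y => Finset.univ.image fun c : F => c • y) hb ?_ ?_ ?_ ?_
  · exact ⟨fun _ => 1, by simp [funext_iff]⟩
  · intro y hy
    exact dens_vecMul_mem (Finset.ne_of_mem_erase hy) B
  · intro y _
    exact Finset.card_image_le.trans (by rw [Finset.card_univ])
  · intro y hy y' _ hy'
    refine dens_vecMul_mem_inter ?_ B
    rw [LinearIndependent.pair_iff' (Finset.ne_of_mem_erase hy)]
    intro c hc
    exact hy' (Finset.mem_image.2 ⟨c, Finset.mem_univ _, hc⟩)

end Uniform

/-! ### The union bound over separations. -/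

section UnionBound

variable {F : Type*} [Field F] [Fintype F]

/-- Disjoint blocks of columns are independent. -/
lemma dens_colRank_eq_and {ι κ : Type*} [Fintype ι] [Fintype κ] [DecidableEq κ] (X : Set κ)
    [Fintype X] [Fintype (Xᶜ : Set κ)] (r s : ℕ) :
    dens {A : Matrix ι κ F | colRank A X = r ∧ colRank A Xᶜ = s} =
      dens {A : Matrix ι X F | A.rank = r} * dens {A : Matrix ι (Xᶜ : Set κ) F | A.rank = s} := by
  classical
  rw [← dens_prod]
  let f : Matrix ι κ F →+ Matrix ι X F × Matrix ι (Xᶜ : Set κ) F :=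
    AddMonoidHom.mk' (fun A => (A.submatrix id (↑), A.submatrix id (↑))) fun A B => rfl
  have hf : Function.Surjective f := by
    rintro ⟨B, C⟩
    refine ⟨fun i j => if h : j ∈ X then B i ⟨j, h⟩ else C i ⟨j, h⟩, ?_⟩
    ext i j
    · exact dif_pos j.2
    · exact dif_neg j.2
  rw [← dens_preimage_hom f hf]
  congr 1
  ext A
  simp only [colRank_eq_rank_submatrix]
  rfl

/-- Here `w` and `u` are the coranks of `X` and its complement, `c` and `d` their nullities, and `l`
is the excess of the rank sum over `n`. The factor `2^c` for `X` and `2^u` for the complement are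
chosen so that the sum over `X` can absorb the former. -/
lemma dens_colRank_eq_and_le {ι κ : Type*} [Fintype ι] [Fintype κ] [DecidableEq κ] {X : Finset κ}
    {u w c d l : ℕ} (hX : X.card = u + l + c)
    (hXc : Fintype.card κ = u + l + c + (w + l + d))
    (hn : Fintype.card ι = u + w + l) :
    dens {A : Matrix ι κ F | colRank A (X : Set κ) = u + l ∧ colRank A (X : Set κ)ᶜ = w + l} ≤
      2 ^ c * ((Fintype.card F : ℝ)⁻¹) ^ (w * c) * (2 ^ u * ((Fintype.card F : ℝ)⁻¹) ^ (u * d)) := by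
  have h1 : Fintype.card (X : Set κ) = u + l + c := by simpa using hX
  have h2 : Fintype.card ((X : Set κ)ᶜ : Set κ) = w + l + d := by
    rw [Fintype.card_compl_set, h1]; omega
  rw [dens_colRank_eq_and]
  exact mul_le_mul (dens_rank_eq_le' (by omega) h1.symm) (dens_rank_eq_le (by omega) h2.symm)
    (dens_nonneg _) (by positivity)

/-- On a nonempty event ranks are at most cardinalities, so the nullities `c`, `d` exist as natural
numbers. -/
lemma colRank_event_cases {ι κ : Type*} [Fintype ι] [Fintype κ] [DecidableEq κ] (X : Finset κ)
    {u w l : ℕ} {b : ℝ} (hb : 0 ≤ b) (hn : Fintype.card ι = u + w + l)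
    (h : ∀ c d, X.card = u + l + c → Fintype.card κ = u + l + c + (w + l + d) →
      2 ^ c * ((Fintype.card F : ℝ)⁻¹) ^ (w * c) *
        (2 ^ u * ((Fintype.card F : ℝ)⁻¹) ^ (u * d)) ≤ b) :
    dens {A : Matrix ι κ F | colRank A (X : Set κ) = u + l ∧ colRank A (X : Set κ)ᶜ = w + l} ≤
      b := by
  rcases Set.eq_empty_or_nonempty
    {A : Matrix ι κ F | colRank A (X : Set κ) = u + l ∧ colRank A (X : Set κ)ᶜ = w + l} with h0 | ⟨A, hA⟩
  · rw [h0]; simpa [dens] using hb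
  · have h1 := colRank_le_ncard A (X : Set κ)
    have h2 := colRank_le_ncard A (X : Set κ)ᶜ
    rw [hA.1, Set.ncard_coe_finset] at h1
    rw [hA.2, Set.ncard_compl, Set.ncard_coe_finset, Nat.card_eq_fintype_card] at h2
    have h3 := Finset.card_le_univ X
    exact (dens_colRank_eq_and_le (c := X.card - (u + l))
      (d := Fintype.card κ - X.card - (w + l)) (by omega) (by omega) hn).trans
      (h _ _ (by omega) (by omega))

/-- The union bound over all column sets with prescribed ranks, in the range where the larger
side has much smaller corank than the smaller side. -/
lemma sum_dens_colRank_le {ι κ : Type*} [Fintype ι] [Fintype κ] [DecidableEq κ] {n m u w l k δ : ℕ}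
    (hι : Fintype.card ι = n) (hκ : Fintype.card κ = m) (hδ : m = n + δ) (hkδ : k ≤ δ)
    (hk : 16 ≤ k) (hkn : 4 * k ≤ n) (hm : m ≤ 2 * n)
    (hlog : ∀ j, Fintype.card F ^ j ≤ 4 * n → 4 * j ≤ n)
    (hn : n = u + w + l) (hu : 1 ≤ u) (huw : u ≤ w) (hl : l + 2 ≤ k) :
    ∑ X : Finset κ, dens {A : Matrix ι κ F |
        colRank A (X : Set κ) = u + l ∧ colRank A (X : Set κ)ᶜ = w + l} ≤
      (2 * (Real.exp 1 * m / k) ^ k * ((Fintype.card F : ℝ)⁻¹) ^ (δ - k)) ^ u := by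
  set q := Fintype.card F with hq
  have hq2 : 2 ≤ q := Fintype.one_lt_card
  have hkm : k ≤ m := by omega
  have hmpos : (0 : ℝ) < m := by exact_mod_cast (show 0 < m by omega)
  have hkpos : (0 : ℝ) < k := by exact_mod_cast (show 0 < k by omega)
  set Q : ℝ := (q : ℝ)⁻¹ with hQ
  have hqpos : (0 : ℝ) < q := by positivity
  have hQ0 : 0 < Q := by positivity
  have hQ1 : Q ≤ 1 := inv_le_one_of_one_le₀ (by exact_mod_cast (by omega : 1 ≤ q))
  set x : ℝ := k / m with hx
  have hx0 : 0 < x := by positivity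
  have hx1 : x ≤ 1 := (div_le_one hmpos).2 (by exact_mod_cast hkm)
  have hQl : ∀ e, e = δ - l → Q ^ e ≤ Q ^ (δ - k) := fun e he =>
    pow_le_pow_of_le_one hQ0.le hQ1 (by omega)
  have hexp : Real.exp 1 * m / k = Real.exp 1 * x⁻¹ := by rw [hx, inv_div]; ring
  -- If the coranks are far apart, `(2 q^(-(w-u)))^c ≤ x^c` with `c = |X| - (u + l)` makes large `X`
  -- unlikely enough to sum by the binomial theorem, and `(1 + x)^m ≤ e^k` for `x = k/m`. If they
  -- are close, `u` is of order `n` and all `2^m` sets can be afforded.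
  by_cases hcase : 2 * Q ^ (w - u) ≤ x
  · have hterm : ∀ X : Finset κ, dens {A : Matrix ι κ F |
        colRank A (X : Set κ) = u + l ∧ colRank A (X : Set κ)ᶜ = w + l} ≤
        x ^ X.card * 1 ^ (Fintype.card κ - X.card) * ((x⁻¹) ^ (u * k) * (2 * Q ^ (δ - k)) ^ u) := by
      intro X
      refine colRank_event_cases X (by positivity) (by omega) fun c d h1 h2 => ?_
      have hcd : c + d = δ - l := by omega
      have hule : u + l ≤ u * k := by
        obtain ⟨u', rfl⟩ := Nat.exists_eq_add_of_le hu
        obtain ⟨k', rfl⟩ := Nat.exists_eq_add_of_le (show 1 ≤ k by omega)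
        nlinarith [Nat.zero_le (u' * k')]
      have hxx : x ^ c ≤ x ^ X.card * (x⁻¹) ^ (u * k) := by
        have : x ^ (c + u * k) ≤ x ^ X.card := pow_le_pow_of_le_one hx0.le hx1 (by omega)
        rw [pow_add] at this
        rw [inv_pow, ← div_eq_mul_inv, le_div_iff₀ (by positivity)]
        exact this
      calc 2 ^ c * Q ^ (w * c) * (2 ^ u * Q ^ (u * d))
          = (2 * Q ^ (w - u)) ^ c * (2 ^ u * (Q ^ (c + d)) ^ u) := by
            have : w = (w - u) + u := by omega
            conv_lhs => rw [this]
            ring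
        _ ≤ x ^ c * (2 ^ u * (Q ^ (δ - k)) ^ u) := by
            have := hQl _ hcd
            gcongr
        _ ≤ (x ^ X.card * (x⁻¹) ^ (u * k)) * (2 ^ u * (Q ^ (δ - k)) ^ u) := by
            gcongr
        _ = _ := by rw [mul_pow, one_pow]; ring
    refine (Finset.sum_le_sum fun X _ => hterm X).trans ?_
    rw [← Finset.sum_mul]
    have hpow : ∑ X : Finset κ, x ^ X.card * 1 ^ (Fintype.card κ - X.card) = (x + 1) ^ m := by
      rw [← hκ]
      exact Fintype.sum_pow_mul_eq_add_pow κ x 1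
    rw [hpow]
    have he : (x + 1) ^ m ≤ (Real.exp 1 ^ k) ^ u := by
      calc (x + 1) ^ m ≤ Real.exp x ^ m := by
            gcongr; exact Real.add_one_le_exp x
        _ = Real.exp 1 ^ k := by
            rw [← Real.exp_nat_mul, ← Real.exp_nat_mul, hx]
            congr 1; field_simp
        _ ≤ _ := le_self_pow₀ (one_le_pow₀ (Real.one_le_exp zero_le_one)) (by omega)
    calc (x + 1) ^ m * ((x⁻¹) ^ (u * k) * (2 * Q ^ (δ - k)) ^ u)
        ≤ (Real.exp 1 ^ k) ^ u * ((x⁻¹) ^ (u * k) * (2 * Q ^ (δ - k)) ^ u) := by gcongr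
      _ = _ := by rw [hexp]; ring
  -- Now `q^(w-u) < 2m ≤ 4n`, so `w - u ≤ n/4`; together with `l < k ≤ n/4` and `n = u + w + l` this
  -- leaves `2u ≥ n/2`.
  · have h4u : n ≤ 4 * u := by
      push Not at hcase
      have h1 : (1 : ℝ) / m ≤ x := by
        rw [hx]; gcongr; exact_mod_cast (show 1 ≤ k by omega)
      have h2 : 1 / (m : ℝ) < 2 / (q : ℝ) ^ (w - u) := by
        refine h1.trans_lt (hcase.trans_eq ?_)
        rw [hQ, inv_pow]; rfl
      rw [div_lt_div_iff₀ hmpos (by positivity)] at h2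
      have h3 : q ^ (w - u) < 2 * m := by
        have : (q : ℝ) ^ (w - u) < 2 * m := by linarith
        exact_mod_cast this
      have := hlog (w - u) (by omega)
      omega
    have hterm : ∀ X : Finset κ, dens {A : Matrix ι κ F |
        colRank A (X : Set κ) = u + l ∧ colRank A (X : Set κ)ᶜ = w + l} ≤
        2 ^ m * (Q ^ (δ - k)) ^ u := by
      intro X
      refine colRank_event_cases X (by positivity) (by omega) fun c d h1 h2 => ?_
      have hcd : c + d = δ - l := by omega
      calc 2 ^ c * Q ^ (w * c) * (2 ^ u * Q ^ (u * d))
          ≤ 2 ^ c * Q ^ (u * c) * (2 ^ u * Q ^ (u * d)) := by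
            have : Q ^ (w * c) ≤ Q ^ (u * c) :=
              pow_le_pow_of_le_one hQ0.le hQ1 (Nat.mul_le_mul_right _ huw)
            gcongr
        _ = 2 ^ (c + u) * (Q ^ (c + d)) ^ u := by ring
        _ ≤ _ := by
            have := hQl _ hcd
            gcongr
            · norm_num
            · omega
    refine (Finset.sum_le_sum fun X _ => hterm X).trans ?_
    rw [Finset.sum_const, Finset.card_univ, Fintype.card_finset, hκ, nsmul_eq_mul]
    -- `4^m ≤ 2^(4n) ≤ 2^(16u)`; this is what `16 ≤ k` is for.
    have hbig : (2 : ℝ) ^ m * 2 ^ m ≤ (2 * (Real.exp 1 * m / k) ^ k) ^ u := by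
      have h2 : (2 : ℝ) ≤ Real.exp 1 * m / k := by
        rw [hexp]
        have h3 : (2 : ℝ) ≤ Real.exp 1 := by have := Real.add_one_le_exp (1 : ℝ); linarith
        have h4 : 1 ≤ x⁻¹ := (one_le_inv₀ hx0).2 hx1
        nlinarith
      calc (2 : ℝ) ^ m * 2 ^ m = 2 ^ (m + m) := (pow_add _ _ _).symm
        _ ≤ 2 ^ (16 * u) := pow_le_pow_right₀ (by norm_num) (by omega)
        _ = (1 * 2 ^ 16) ^ u := by rw [one_mul, pow_mul]
        _ ≤ (2 * 2 ^ k) ^ u := by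
            gcongr
            · norm_num
            · norm_num
        _ ≤ _ := by gcongr
    rw [← mul_assoc]
    push_cast
    rw [mul_pow _ (Q ^ (δ - k)) u]
    gcongr

lemma dens_not_isVerticallyConnected_le {n m k δ : ℕ} (hδ : m = n + δ) (hkδ : k ≤ δ)
    (hk : 16 ≤ k) (hkn : 4 * k ≤ n) (hm : m ≤ 2 * n)
    (hlog : ∀ j, Fintype.card F ^ j ≤ 4 * n → 4 * j ≤ n) {θ : ℝ}
    (hθ : 2 * (Real.exp 1 * m / k) ^ k * ((Fintype.card F : ℝ)⁻¹) ^ (δ - k) ≤ θ) (hθ2 : θ ≤ 1 / 2) :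
    dens {A : Matrix (Fin n) (Fin m) F |
        A.rank = n ∧ ¬ IsVerticallyConnected (representedMatroid A) k} ≤ 2 * k * θ := by
  classical
  set θ₀ : ℝ := 2 * (Real.exp 1 * m / k) ^ k * ((Fintype.card F : ℝ)⁻¹) ^ (δ - k) with hθ₀
  have hθ₀0 : 0 ≤ θ₀ := by positivity
  let S : ℕ × ℕ → Finset (Fin m) → Set (Matrix (Fin n) (Fin m) F) := fun p X =>
    {A | colRank A (X : Set (Fin m)) = p.2 + p.1 ∧
      colRank A (X : Set (Fin m))ᶜ = (n - p.2 - p.1) + p.1}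
  let I : Finset (ℕ × ℕ) := (Finset.range k ×ˢ Finset.Icc 1 n).filter fun p =>
    p.1 + 2 ≤ k ∧ 2 * p.2 + p.1 ≤ n
  have hsub : {A : Matrix (Fin n) (Fin m) F |
      A.rank = n ∧ ¬ IsVerticallyConnected (representedMatroid A) k} ⊆
      ⋃ p ∈ I, ⋃ X ∈ (Finset.univ : Finset (Finset (Fin m))), S p X := by
    rintro A ⟨hr, hA⟩
    obtain ⟨X, h1, h2, h3⟩ := exists_of_not_isVerticallyConnected hA
    have h4 := rank_le_colRank_add A X
    rw [hr] at h2 h3 h4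
    simp only [Set.mem_iUnion]
    -- The pair is `(l, u)`: the excess of the rank sum over `n`, and the corank of the complement,
    -- positive because the complement is nonspanning.
    refine ⟨(colRank A X + colRank A Xᶜ - n, n - colRank A Xᶜ), ?_, X.toFinset,
      Finset.mem_univ _, ?_⟩
    · simp only [I, Finset.mem_filter, Finset.mem_product, Finset.mem_range, Finset.mem_Icc]
      omega
    · simp only [S, Set.coe_toFinset, Set.mem_ofPred_eq]
      omega
  have hsum : ∀ p ∈ I, ∑ X : Finset (Fin m), dens (S p X) ≤ θ₀ ^ p.2 := by
    rintro ⟨l, u⟩ hp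
    simp only [I, Finset.mem_filter, Finset.mem_product, Finset.mem_range, Finset.mem_Icc] at hp
    exact sum_dens_colRank_le (Fintype.card_fin n) (Fintype.card_fin m) hδ hkδ hk hkn hm hlog
      (w := n - u - l) (by omega) (by omega) (by omega) (by omega)
  calc _ ≤ _ := dens_mono hsub
    _ ≤ ∑ p ∈ I, dens (⋃ X ∈ (Finset.univ : Finset (Finset (Fin m))), S p X) :=
        dens_biUnion_le _ _
    _ ≤ ∑ p ∈ I, θ₀ ^ p.2 := Finset.sum_le_sum fun p hp => (dens_biUnion_le _ _).trans (hsum p hp)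
    _ ≤ ∑ p ∈ Finset.range k ×ˢ Finset.Icc 1 n, θ ^ p.2 := by
        refine (Finset.sum_le_sum_of_subset_of_nonneg (Finset.filter_subset _ _)
          fun p _ _ => pow_nonneg hθ₀0 _).trans (Finset.sum_le_sum fun p _ => ?_)
        gcongr
    _ = k * ∑ u ∈ Finset.Icc 1 n, θ ^ u := by
        simp only [Finset.sum_product, Finset.sum_const, Finset.card_range, nsmul_eq_mul]
    _ ≤ k * (2 * θ) := by
        have hθ0 : 0 ≤ θ := hθ₀0.trans hθ
        -- The subtracted tail makes the geometric sum inductive, given `θ ≤ 1/2`.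
        have : ∀ N : ℕ, ∑ u ∈ Finset.Icc 1 N, θ ^ u ≤ 2 * θ - θ ^ (N + 1) * 2 := by
          intro N
          induction N with
          | zero => simp; linarith
          | succ N ih =>
            rw [Finset.sum_Icc_succ_top (by omega)]
            have := pow_nonneg hθ0 (N + 1)
            have h2 : θ ^ (N + 1 + 1) = θ ^ (N + 1) * θ := pow_succ _ _
            nlinarith
        have h1 := this n
        have h2 := pow_nonneg hθ0 (n + 1)
        gcongr
        linarith
    _ = _ := by ring

end UnionBound

/-! ### Estimates for binomial coefficients. -/

section Bounds

lemma pow_div_le_choose {m j : ℕ} (h : j ≤ m) : ((m : ℝ) / j) ^ j ≤ m.choose j := by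
  induction j generalizing m with
  | zero => simp
  | succ j ih =>
    obtain ⟨m, rfl⟩ : ∃ m', m = m' + 1 := ⟨m - 1, by omega⟩
    have hjm : j ≤ m := by omega
    have h1 := ih hjm
    have h2 : (((m + 1 : ℕ) : ℝ) / (j + 1 : ℕ)) ^ j ≤ ((m : ℝ) / j) ^ j := by
      rcases Nat.eq_zero_or_pos j with rfl | hj
      · simp
      · have : (0 : ℝ) < j := by exact_mod_cast hj
        have hjm' : (j : ℝ) ≤ m := by exact_mod_cast hjm
        gcongr ?_ ^ j
        rw [div_le_div_iff₀ (by positivity) this]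
        push_cast
        nlinarith
    have h3 : (((m + 1).choose (j + 1) : ℕ) : ℝ) =
        ((m + 1 : ℕ) : ℝ) / (j + 1 : ℕ) * m.choose j := by
      rw [div_mul_eq_mul_div, eq_div_iff (by positivity)]
      exact_mod_cast (Nat.add_one_mul_choose_eq m j).symm
    rw [h3, pow_succ, mul_comm]
    gcongr
    exact h2.trans h1

lemma log_factorial_le (j : ℕ) :
    Real.log j.factorial ≤ j * Real.log j - j + Real.log j + 1 := by
  induction j with
  | zero => simp
  | succ j ih =>
    rcases Nat.eq_zero_or_pos j with rfl | hj
    · simp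
    have hj' : (0 : ℝ) < j := by exact_mod_cast hj
    rw [Nat.factorial_succ, Nat.cast_mul, Real.log_mul (by positivity) (by positivity)]
    have h1 : Real.log ((j : ℝ) / (j + 1)) ≤ (j : ℝ) / (j + 1) - 1 :=
      Real.log_le_sub_one_of_pos (by positivity)
    rw [Real.log_div (by positivity) (by positivity)] at h1
    have h2 : (j : ℝ) / (j + 1) - 1 = -(1 / (j + 1)) := by field_simp; ring
    rw [h2] at h1
    have h3 : ((j : ℝ) + 1) * (Real.log j - Real.log (j + 1)) ≤ -1 := by
      calc _ ≤ ((j : ℝ) + 1) * -(1 / (j + 1)) := by gcongr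
        _ = -1 := by field_simp
    push_cast
    linarith

/-- Stirling from below for `m!`, `log_factorial_le` for the other two factorials; each of these
costs at most `log m + 1`. -/
lemma le_log_choose {m j : ℕ} (h : j ≤ m) (hm : m ≠ 0) :
    m * Real.log m - j * Real.log j - (m - j : ℕ) * Real.log (m - j : ℕ) - 2 * Real.log m - 2 ≤
      Real.log (m.choose j) := by
  have hf : ∀ i : ℕ, ((i.factorial : ℕ) : ℝ) ≠ 0 := fun i => by positivity
  have h1 := congrArg Real.log (congrArg (Nat.cast (R := ℝ)) (Nat.choose_mul_factorial_mul_factorial h))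
  have hc : ((m.choose j : ℕ) : ℝ) ≠ 0 := by exact_mod_cast (Nat.choose_pos h).ne'
  rw [Nat.cast_mul, Nat.cast_mul, Real.log_mul (mul_ne_zero hc (hf _)) (hf _),
    Real.log_mul hc (hf _)] at h1
  have h2 := Stirling.le_log_factorial_stirling hm
  have h3 := log_factorial_le j
  have h4 := log_factorial_le (m - j)
  have hmono : ∀ i : ℕ, i ≤ m → Real.log i ≤ Real.log m := by
    intro i hi
    rcases Nat.eq_zero_or_pos i with rfl | hi0
    · simpa using Real.log_natCast_nonneg m
    · exact Real.log_le_log (by exact_mod_cast hi0) (by exact_mod_cast hi)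
  have h5 := hmono j h
  have h6 := hmono (m - j) (Nat.sub_le _ _)
  have h7 : 0 ≤ Real.log m := Real.log_natCast_nonneg m
  have h8 : 0 ≤ Real.log (2 * Real.pi) := Real.log_nonneg (by linarith [Real.pi_gt_three])
  have h9 : ((m - j : ℕ) : ℝ) = m - j := Nat.cast_sub h
  linarith

/-- If `4j > n ≥ 28` then `j ≥ 8`, whence `4n < 16j < 2^j ≤ q^j`. -/
lemma four_mul_le_of_pow_le {q n j : ℕ} (hq : 2 ≤ q) (hn : 28 ≤ n) (h : q ^ j ≤ 4 * n) :
    4 * j ≤ n := by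
  by_contra hlt
  push Not at hlt
  have h1 : 2 ^ j ≤ q ^ j := Nat.pow_le_pow_left hq j
  have h2 : ∀ i, 16 * (i + 8) < 2 ^ (i + 8) := by
    intro i
    induction i with
    | zero => norm_num
    | succ i ih => rw [show i + 1 + 8 = (i + 8) + 1 by ring, pow_succ]; omega
  have h3 := h2 (j - 8)
  rw [Nat.sub_add_cancel (by omega)] at h3
  omega

/-- The entropy limit, needed only as a lower bound. Writing it with `c * log c`, continuous also at
`0`, avoids boundary cases. -/
lemma tendsto_log_choose_div {k m : ℕ → ℕ} {μ t : ℝ} (ht : t < μ) (hμ : 0 < μ)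
    (hk : Tendsto (fun n => (k n : ℝ) / n) atTop (𝓝 t))
    (hm : Tendsto (fun n => (m n : ℝ) / n) atTop (𝓝 μ)) :
    ∃ f : ℕ → ℝ, (∀ᶠ n in atTop, f n ≤ Real.log ((m n).choose (k n)) / n) ∧
      Tendsto f atTop (𝓝 (μ * Real.log μ - t * Real.log t - (μ - t) * Real.log (μ - t))) := by
  have hφ : ∀ {c : ℕ → ℝ} {x : ℝ}, Tendsto c atTop (𝓝 x) →
      Tendsto (fun n => c n * Real.log (c n)) atTop (𝓝 (x * Real.log x)) := fun h =>
    (Real.continuous_mul_log.tendsto _).comp h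
  have hn : ∀ᶠ n : ℕ in atTop, (0 : ℝ) < n := by
    filter_upwards [eventually_gt_atTop 0] with n hn
    exact_mod_cast hn
  have hinv : Tendsto (fun n : ℕ => 1 / (n : ℝ)) atTop (𝓝 0) :=
    tendsto_one_div_atTop_nhds_zero_nat
  have hmtop : Tendsto (fun n => (m n : ℝ)) atTop atTop := by
    have := hm.pos_mul_atTop hμ tendsto_natCast_atTop_atTop
    refine this.congr' ?_
    filter_upwards [hn] with n hn
    field_simp
  have hlogm : Tendsto (fun n => Real.log (m n) / n) atTop (𝓝 0) := by
    have h1 : Tendsto (fun n => Real.log (m n) / m n) atTop (𝓝 0) :=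
      (Real.isLittleO_log_id_atTop.tendsto_div_nhds_zero).comp hmtop
    have h2 := h1.mul hm
    rw [zero_mul] at h2
    refine h2.congr' ?_
    filter_upwards [hn, hmtop.eventually_gt_atTop 0] with n hn hmn
    field_simp
  refine ⟨fun n => (m n : ℝ) / n * Real.log ((m n : ℝ) / n) - (k n : ℝ) / n * Real.log ((k n : ℝ) / n)
    - ((m n : ℝ) / n - k n / n) * Real.log ((m n : ℝ) / n - k n / n)
    - 2 * (Real.log (m n) / n) - 2 * (1 / n), ?_, ?_⟩
  · filter_upwards [hn, hmtop.eventually_gt_atTop 0, hk.eventually_lt hm ht] with n hn hmn hkm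
    have hkm' : k n ≤ m n := by
      rw [div_lt_div_iff_of_pos_right hn] at hkm
      exact_mod_cast hkm.le
    have hs : ∀ c : ℝ, 0 ≤ c → c * Real.log c = n * (c / n * Real.log (c / n)) + c * Real.log n := by
      intro c hc
      rcases hc.eq_or_lt with rfl | hc
      · simp
      · rw [Real.log_div hc.ne' hn.ne']
        field_simp
        ring
    have h1 := le_log_choose hkm' (by exact_mod_cast hmn.ne')
    rw [hs (m n) hmn.le, hs (k n) (Nat.cast_nonneg _), hs _ (Nat.cast_nonneg (m n - k n)),
      Nat.cast_sub hkm', sub_div] at h1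
    rw [le_div_iff₀ hn]
    refine le_of_eq_of_le ?_ h1
    field_simp
    ring
  · have := ((((hφ hm).sub (hφ hk)).sub (hφ (hm.sub hk))).sub (hlogm.const_mul 2)).sub
      (hinv.const_mul 2)
    simpa using this

end Bounds

/-! ### Limits of probabilities and the lower bound on the connectivity time. -/

section Asymptotic

variable {Ω : ℕ → Type*} [∀ n, MeasurableSpace (Ω n)]
  {P : ∀ n, Measure (Ω n)}

/-- Limits are proved for complements because subadditivity then suffices and no event need be shown
measurable. -/
lemma AAS.of_tendsto_compl [∀ n, IsProbabilityMeasure (P n)] {E : ∀ n, Set (Ω n)}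
    (h : Tendsto (fun n => P n (E n)ᶜ) atTop (𝓝 0)) : AAS P E := by
  have h1 : Tendsto (fun n => 1 - P n (E n)ᶜ) atTop (𝓝 1) := by
    have := ENNReal.Tendsto.sub (tendsto_const_nhds (x := (1 : ENNReal)) (f := (atTop : Filter ℕ)))
      h (Or.inl ENNReal.one_ne_top)
    simpa using this
  refine tendsto_of_tendsto_of_tendsto_of_le_of_le h1 tendsto_const_nhds (fun n => ?_)
    fun n => prob_le_one
  refine tsub_le_iff_right.2 ?_
  calc (1 : ENNReal) = P n Set.univ := measure_univ.symm
    _ = P n (E n ∪ (E n)ᶜ) := by rw [Set.union_compl_self]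
    _ ≤ _ := measure_union_le _ _

lemma tendsto_compl_of_subset {E : ∀ n, Set (Ω n)} {b : ℕ → ℝ} (hb : Tendsto b atTop (𝓝 0))
    (h : ∀ᶠ n in atTop, ∃ B : Set (Ω n), (E n)ᶜ ⊆ B ∧ P n B ≤ ENNReal.ofReal (b n)) :
    Tendsto (fun n => P n (E n)ᶜ) atTop (𝓝 0) := by
  have h1 := ENNReal.tendsto_ofReal hb
  rw [ENNReal.ofReal_zero] at h1
  refine tendsto_of_tendsto_of_tendsto_of_le_of_le' tendsto_const_nhds h1
    (Eventually.of_forall fun n => zero_le) ?_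
  filter_upwards [h] with n ⟨B, hB, hPB⟩
  exact (measure_mono hB).trans hPB

lemma tendsto_compl_inter {E E' : ∀ n, Set (Ω n)}
    (h : Tendsto (fun n => P n (E n)ᶜ) atTop (𝓝 0))
    (h' : Tendsto (fun n => P n (E' n)ᶜ) atTop (𝓝 0)) :
    Tendsto (fun n => P n (E n ∩ E' n)ᶜ) atTop (𝓝 0) := by
  have h1 := h.add h'
  rw [add_zero] at h1
  refine tendsto_of_tendsto_of_tendsto_of_le_of_le tendsto_const_nhds h1
    (fun n => zero_le) fun n => ?_
  rw [Set.compl_inter]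
  exact measure_union_le _ _

lemma tendsto_compl_mono {E E' : ∀ n, Set (Ω n)}
    (h : Tendsto (fun n => P n (E n)ᶜ) atTop (𝓝 0)) (hE : ∀ᶠ n in atTop, E n ⊆ E' n) :
    Tendsto (fun n => P n (E' n)ᶜ) atTop (𝓝 0) := by
  refine tendsto_of_tendsto_of_tendsto_of_le_of_le' tendsto_const_nhds h
    (Eventually.of_forall fun n => zero_le) ?_
  filter_upwards [hE] with n hn
  exact measure_mono (Set.compl_subset_compl.2 hn)

variable {F : Type*} [Field F] [Fintype F]

lemma tendsto_inv_card_pow {f : ℕ → ℕ} (hf : Tendsto f atTop atTop) :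
    Tendsto (fun n => ((Fintype.card F : ℝ)⁻¹) ^ f n) atTop (𝓝 0) := by
  have hq : (1 : ℝ) < Fintype.card F := by exact_mod_cast Fintype.one_lt_card
  exact (tendsto_pow_atTop_nhds_zero_of_lt_one (by positivity) (inv_lt_one_of_one_lt₀ hq)).comp hf

/-- A lower bound for the expected number of words of weight less than `k` in the row space, from
those of weight exactly `k - 1`. -/
lemma choose_mul_le_dens_lowWeight {n m k : ℕ} (hk : 0 < k) :
    (m.choose (k - 1) : ℝ) * ((Fintype.card F : ℝ) - 1) ^ (k - 1) * (Fintype.card F : ℝ) ^ n /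
      (Fintype.card F : ℝ) ^ m ≤ (Fintype.card F : ℝ) ^ n * dens (lowWeight F m k) := by
  have h := choose_mul_pow_le_ncard_lowWeight (F := F) (m := m) (show k - 1 < k by omega)
  have h' : (m.choose (k - 1) : ℝ) * ((Fintype.card F : ℝ) - 1) ^ (k - 1) ≤
      (lowWeight F m k).ncard := by
    rw [← Nat.cast_pred Fintype.card_pos]
    exact_mod_cast h
  rw [dens, Nat.card_eq_fintype_card, Fintype.card_fun, Fintype.card_fin, Nat.cast_pow,
    mul_div_assoc', mul_comm ((Fintype.card F : ℝ) ^ n)]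
  gcongr

variable [∀ n, IsProbabilityMeasure (P n)] [MeasurableSpace F] [DiscreteMeasurableSpace F]
  {v : ∀ n, ℕ → Ω n → Fin n → F}

/-- If the expected number of low-weight words in the row space of `A_m` tends to infinity, then
asymptotically almost surely the matroid is not vertically `k`-connected at any time up to `m`. -/
lemma tendsto_compl_lt_connTime (hv : ∀ n, IsUniformColumnSequence (P n) (v n)) {k m : ℕ → ℕ}
    (hk : Tendsto k atTop atTop) (hkn : ∀ᶠ n in atTop, k n < n)
    (hE : Tendsto (fun n => (Fintype.card F : ℝ) ^ n * dens (lowWeight F (m n) (k n))) atTop atTop) :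
    Tendsto (fun n => P n {ω | (m n + 1 : ℕ) ≤ connTime (fun i => v n i ω) (k n)}ᶜ)
      atTop (𝓝 0) := by
  set q : ℝ := (Fintype.card F : ℝ) with hq
  have hq1 : 1 < q := by rw [hq]; exact_mod_cast Fintype.one_lt_card
  have hq2 : 2 ≤ q := by
    rw [hq]; exact_mod_cast (show 2 ≤ Fintype.card F from Fintype.one_lt_card)
  have hw : Tendsto (fun n => k n / 4) atTop atTop :=
    (Nat.tendsto_div_const_atTop (by norm_num)).comp hk
  have hb : Tendsto (fun n => q⁻¹ ^ (k n / 4) + q⁻¹ ^ (k n / 4) +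
      2 * q / (q ^ n * dens (lowWeight F (m n) (k n)))) atTop (𝓝 0) := by
    have := ((tendsto_inv_card_pow (F := F) hw).add (tendsto_inv_card_pow (F := F) hw)).add
      (hE.const_div_atTop (2 * q))
    simpa using this
  refine tendsto_compl_of_subset hb ?_
  filter_upwards [hkn, hk.eventually_ge_atTop 4, eventually_gt_atTop 0,
    hE.eventually_gt_atTop 0] with n hkn hk4 hn0 hEpos
  set w := k n / 4 with hwdef
  let S₁ : Set (Matrix (Fin n) (Fin (n - w)) F) := {A | ∃ x, x ≠ 0 ∧ A.mulVec x = 0}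
  let S₂ : Set (Matrix (Fin n) (Fin (n + w)) F) := {A | ∃ y, y ≠ 0 ∧ Matrix.vecMul y A = 0}
  let S₃ : Set (Matrix (Fin n) (Fin (m n)) F) :=
    {A | ∀ y, y ≠ 0 → Matrix.vecMul y A ∉ lowWeight F (m n) (k n)}
  refine ⟨({ω | columnMatrix (fun i => v n i ω) (n - w) ∈ S₁} ∪
    {ω | columnMatrix (fun i => v n i ω) (n + w) ∈ S₂}) ∪
    {ω | columnMatrix (fun i => v n i ω) (m n) ∈ S₃}, ?_, ?_⟩
  · rw [Set.compl_subset_comm]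
    intro ω hω
    simp only [Set.mem_compl_iff, Set.mem_union, Set.mem_ofPred_eq, not_or, S₁, S₂, S₃] at hω
    push Not at hω
    obtain ⟨⟨h1, h2⟩, h3⟩ := hω
    exact lt_connTime fun m' hm2 hm' => not_isVerticallyConnected_columnMatrix (w := w) (by omega)
      (by omega) hkn.le h1 h2 h3 hm2 hm'
  · have : Nonempty (Fin n) := ⟨⟨0, hn0⟩⟩
    have h1 : dens S₁ ≤ q⁻¹ ^ w := by
      refine dens_exists_mulVec_eq_zero_le.trans_eq ?_
      rw [Fintype.card_fin, Fintype.card_fin]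
      have : q⁻¹ ^ n = q⁻¹ ^ (n - w) * q⁻¹ ^ w := by
        rw [← pow_add]; congr 1; omega
      rw [← hq, this, ← mul_assoc, ← mul_pow, mul_inv_cancel₀ (by positivity), one_pow, one_mul]
    have h2 : dens S₂ ≤ q⁻¹ ^ w := by
      refine dens_exists_vecMul_eq_zero_le.trans_eq ?_
      rw [Fintype.card_fin, Fintype.card_fin, ← hq, pow_add, ← mul_assoc, ← mul_pow,
        mul_inv_cancel₀ (by positivity), one_pow, one_mul]
    have h3 : dens S₃ ≤ 2 * q / (q ^ n * dens (lowWeight F (m n) (k n))) := by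
      refine (dens_forall_vecMul_notMem_le _ ⟨0, ?_⟩).trans ?_
      · simp only [lowWeight, Set.mem_ofPred_eq]
        simp
        omega
      · have hqn : q ≤ q ^ n := le_self_pow₀ hq1.le hn0.ne'
        have hd : 0 < dens (lowWeight F (m n) (k n)) :=
          pos_of_mul_pos_right hEpos (by positivity)
        rw [Fintype.card_fin, ← hq, div_le_div_iff₀ (mul_pos (by linarith) hd) hEpos]
        -- Only the `q^n - 1` nonzero `y` count, which accounts for the factor `2`.
        have : q ^ n ≤ 2 * (q ^ n - 1) := by linarith
        calc q * (q ^ n * dens (lowWeight F (m n) (k n)))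
            ≤ q * (2 * (q ^ n - 1) * dens (lowWeight F (m n) (k n))) := by gcongr
          _ = _ := by ring
    refine (measure_union_le _ _).trans ?_
    refine (add_le_add (measure_union_le _ _) le_rfl).trans ?_
    rw [measure_columnMatrix_mem (hv n), measure_columnMatrix_mem (hv n),
      measure_columnMatrix_mem (hv n), ← ENNReal.ofReal_add (dens_nonneg _) (dens_nonneg _),
      ← ENNReal.ofReal_add (add_nonneg (dens_nonneg _) (dens_nonneg _)) (dens_nonneg _)]
    exact ENNReal.ofReal_le_ofReal (by linarith)

lemma tendsto_compl_mul_le_connTime (hv : ∀ n, IsUniformColumnSequence (P n) (v n)) {k : ℕ → ℕ}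
    {t α : ℝ} (ht0 : 0 < t) (ht1 : t < 1) (hα : 0 ≤ α)
    (hk : Tendsto (fun n => (k n : ℝ) / n) atTop (𝓝 t))
    (hpos : 0 < t * Real.log ((1 + α) / t) +
      (1 + α - t) * Real.log ((1 + α) / (1 + α - t)) +
      t * Real.log ((Fintype.card F : ℝ) - 1) - α * Real.log (Fintype.card F)) :
    Tendsto (fun n => P n {ω | ∀ τ : ℕ, connTime (fun i => v n i ω) (k n) = τ →
      (1 + α) * n ≤ τ}ᶜ) atTop (𝓝 0) := by
  set q : ℝ := (Fintype.card F : ℝ) with hq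
  have hq2 : 2 ≤ q := by
    rw [hq]; exact_mod_cast (show 2 ≤ Fintype.card F from Fintype.one_lt_card)
  let m : ℕ → ℕ := fun n => ⌊(1 + α) * n⌋₊
  have hn : ∀ᶠ n : ℕ in atTop, (0 : ℝ) < n := by
    filter_upwards [eventually_gt_atTop 0] with n hn
    exact_mod_cast hn
  have hm : Tendsto (fun n => (m n : ℝ) / n) atTop (𝓝 (1 + α)) :=
    (tendsto_nat_floor_mul_div_atTop (by linarith)).comp tendsto_natCast_atTop_atTop
  have hktop : Tendsto k atTop atTop := by
    have : Tendsto (fun n => (k n : ℝ)) atTop atTop := by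
      refine (hk.pos_mul_atTop ht0 tendsto_natCast_atTop_atTop).congr' ?_
      filter_upwards [hn] with n hn
      field_simp
    exact tendsto_natCast_atTop_iff.1 this
  have hkn : ∀ᶠ n in atTop, k n < n := by
    filter_upwards [hk.eventually_lt_const ht1, hn] with n h hn
    rw [div_lt_one hn] at h
    exact_mod_cast h
  have hk1 : Tendsto (fun n => ((k n - 1 : ℕ) : ℝ) / n) atTop (𝓝 t) := by
    have h1 : Tendsto (fun n : ℕ => 1 / (n : ℝ)) atTop (𝓝 0) :=
      tendsto_one_div_atTop_nhds_zero_nat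
    have h2 := hk.sub h1
    rw [sub_zero] at h2
    refine h2.congr' ?_
    filter_upwards [hktop.eventually_ge_atTop 1] with n h
    rw [Nat.cast_sub h, Nat.cast_one, sub_div]
  obtain ⟨f, hf, hflim⟩ := tendsto_log_choose_div (by linarith) (by linarith) hk1 hm
  have hE : Tendsto (fun n => q ^ n * dens (lowWeight F (m n) (k n))) atTop atTop := by
    -- `g n * n` bounds from below the logarithm of the expected number of light words; its limit
    -- rate is the expression assumed positive.
    let g : ℕ → ℝ := fun n => f n + ((k n - 1 : ℕ) : ℝ) / n * Real.log (q - 1) + Real.log q -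
      (m n : ℝ) / n * Real.log q
    have hg : Tendsto g atTop (𝓝 (t * Real.log ((1 + α) / t) +
        (1 + α - t) * Real.log ((1 + α) / (1 + α - t)) + t * Real.log (q - 1) -
        α * Real.log q)) := by
      have h1 := ((hflim.add (hk1.mul_const (Real.log (q - 1)))).add_const (Real.log q)).sub
        (hm.mul_const (Real.log q))
      convert h1 using 2
      rw [Real.log_div (by linarith) (by linarith), Real.log_div (by linarith) (by linarith)]
      ring
    have h1 : Tendsto (fun n => Real.exp (g n * n)) atTop atTop :=
      Real.tendsto_exp_atTop.comp (hg.pos_mul_atTop hpos tendsto_natCast_atTop_atTop)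
    refine tendsto_atTop_mono' _ ?_ h1
    filter_upwards [hf, hn, hktop.eventually_ge_atTop 1, hkn] with n hfn hn hkn1 hkn
    refine le_trans ?_ (choose_mul_le_dens_lowWeight (F := F) (n := n) (by omega))
    rw [← hq]
    have hmn : n ≤ m n := Nat.le_floor (by nlinarith)
    have hc : (0 : ℝ) < (m n).choose (k n - 1) := by
      exact_mod_cast Nat.choose_pos (by omega)
    have hq1 : 0 < q - 1 := by linarith
    have hR : 0 < ((m n).choose (k n - 1) : ℝ) * (q - 1) ^ (k n - 1) * q ^ n / q ^ m n := by
      positivity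
    rw [← Real.exp_log hR, Real.exp_le_exp, Real.log_div (by positivity) (by positivity),
      Real.log_mul (by positivity) (by positivity), Real.log_mul (by positivity) (by positivity),
      Real.log_pow, Real.log_pow, Real.log_pow]
    rw [le_div_iff₀ hn] at hfn
    have : g n * n = f n * n + ((k n - 1 : ℕ) : ℝ) * Real.log (q - 1) + n * Real.log q -
        m n * Real.log q := by
      simp only [g]; field_simp
    rw [this]
    linarith
  refine tendsto_compl_mono (tendsto_compl_lt_connTime hv hktop hkn hE) (Eventually.of_forall ?_)
  intro n ω hω τ hτ
  rw [Set.mem_ofPred_eq, hτ] at hω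
  have h1 : m n + 1 ≤ τ := by exact_mod_cast hω
  have h2 := Nat.lt_floor_add_one ((1 + α) * n)
  have h3 : ((m n + 1 : ℕ) : ℝ) ≤ τ := by exact_mod_cast h1
  push_cast at h3
  exact h2.le.trans h3

end Asymptotic

/-! ### The sublinear regime. -/

section Sublinear

variable {Ω : ℕ → Type*} [∀ n, MeasurableSpace (Ω n)]
  {P : ∀ n, Measure (Ω n)} [∀ n, IsProbabilityMeasure (P n)]
  {F : Type*} [Field F] [Fintype F] [MeasurableSpace F] [DiscreteMeasurableSpace F]
  {v : ∀ n, ℕ → Ω n → Fin n → F}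

lemma tendsto_div_atTop_of_isLittleO {k : ℕ → ℕ} (hk : Tendsto k atTop atTop)
    (ho : (fun n => (k n : ℝ)) =o[atTop] fun n => (n : ℝ)) :
    Tendsto (fun n : ℕ => (n : ℝ) / k n) atTop atTop := by
  have h1 : Tendsto (fun n : ℕ => (k n : ℝ) / n) atTop (𝓝[>] 0) := by
    refine tendsto_nhdsWithin_iff.2 ⟨ho.tendsto_div_nhds_zero, ?_⟩
    filter_upwards [hk.eventually_gt_atTop 0, eventually_gt_atTop 0] with n h1 h2
    have : (0 : ℝ) < k n := by exact_mod_cast h1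
    have : (0 : ℝ) < n := by exact_mod_cast h2
    exact Set.mem_Ioi.2 (by positivity)
  refine (tendsto_inv_nhdsGT_zero.comp h1).congr fun n => ?_
  simp

lemma rpow_mul_logb {q y c : ℝ} (hq : 1 < q) (hy : 0 < y) (k : ℕ) :
    q ^ (c * (k * Real.logb q y)) = y ^ (c * k) := by
  rw [show c * (k * Real.logb q y) = Real.logb q y * (c * k) by ring,
    Real.rpow_mul (by linarith), Real.rpow_logb (by linarith) hq.ne' hy]

lemma tendsto_compl_le_connTime_of_isLittleO (hv : ∀ n, IsUniformColumnSequence (P n) (v n))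
    {k : ℕ → ℕ} (hk : Tendsto k atTop atTop)
    (ho : (fun n => (k n : ℝ)) =o[atTop] fun n => (n : ℝ)) {ε : ℝ} (hε : 0 < ε) (hε1 : ε ≤ 1) :
    Tendsto (fun n => P n {ω | (n + ⌊(1 - ε) * (k n * Real.logb (Fintype.card F) (n / k n))⌋₊ + 1 : ℕ)
      ≤ connTime (fun i => v n i ω) (k n)}ᶜ) atTop (𝓝 0) := by
  set q : ℝ := (Fintype.card F : ℝ) with hq
  have hq2 : 2 ≤ q := by
    rw [hq]; exact_mod_cast (show 2 ≤ Fintype.card F from Fintype.one_lt_card)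
  have hy := tendsto_div_atTop_of_isLittleO hk ho
  refine tendsto_compl_lt_connTime hv hk ?_ ?_
  · filter_upwards [hy.eventually_gt_atTop 1, hk.eventually_gt_atTop 0] with n h1 h2
    rw [lt_div_iff₀ (by exact_mod_cast h2), one_mul] at h1
    exact_mod_cast h1
  refine tendsto_atTop_mono' _ ?_ hy
  have hkε : ∀ᶠ n in atTop, 2 ≤ ε * k n := by
    have : Tendsto (fun n => ε * (k n : ℝ)) atTop atTop :=
      (tendsto_natCast_atTop_atTop.comp hk).const_mul_atTop hε
    exact this.eventually_ge_atTop 2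
  filter_upwards [hy.eventually_gt_atTop 1, hk.eventually_ge_atTop 2, hkε] with n hy1 hk2 hkε
  set y : ℝ := (n : ℝ) / k n with hydef
  set L : ℝ := k n * Real.logb q y with hL
  have hL0 : 0 ≤ L := by
    have := Real.logb_nonneg (b := q) (by linarith) hy1.le
    positivity
  set d := ⌊(1 - ε) * L⌋₊ with hd
  have hkpos : (0 : ℝ) < k n := by exact_mod_cast (show 0 < k n by omega)
  have hkn : k n < n := by
    rw [hydef, lt_div_iff₀ hkpos, one_mul] at hy1
    exact_mod_cast hy1
  refine le_trans ?_ (choose_mul_le_dens_lowWeight (F := F) (n := n) (m := n + d) (by omega))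
  rw [← hq]
  have h1 : y ^ (k n - 1) ≤ (n + d).choose (k n - 1) := by
    refine le_trans ?_ (pow_div_le_choose (by omega))
    have hk1 : (0 : ℝ) < (k n - 1 : ℕ) := by exact_mod_cast (show 0 < k n - 1 by omega)
    rw [hydef]
    gcongr
    · omega
    · omega
  have h2 : q ^ d ≤ y ^ ((1 - ε) * k n) := by
    rw [← rpow_mul_logb (by linarith : 1 < q) (by linarith), ← Real.rpow_natCast]
    exact Real.rpow_le_rpow_of_exponent_le (by linarith)
      (Nat.floor_le (mul_nonneg (by linarith) hL0))
  have h3 : (1 : ℝ) ≤ (q - 1) ^ (k n - 1) := one_le_pow₀ (by linarith)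
  -- The expectation is at least `y^(k-1) / q^d ≥ y^(εk-1)`, and `εk ≥ 2` makes this at least `y`.
  have h4 : y * y ^ ((1 - ε) * k n) ≤ y ^ (k n - 1) := by
    rw [← Real.rpow_natCast y (k n - 1), mul_comm, ← Real.rpow_add_one (by linarith),
      Nat.cast_sub (by omega)]
    refine Real.rpow_le_rpow_of_exponent_le hy1.le ?_
    push_cast
    linarith
  rw [pow_add, le_div_iff₀ (by positivity)]
  calc y * (q ^ n * q ^ d) = y * q ^ d * 1 * q ^ n := by ring
    _ ≤ y * y ^ ((1 - ε) * k n) * 1 * q ^ n := by gcongr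
    _ ≤ (n + d).choose (k n - 1) * (q - 1) ^ (k n - 1) * q ^ n := by
        have := h4.trans h1
        gcongr

lemma tendsto_compl_connTime_le_of_isLittleO (hv : ∀ n, IsUniformColumnSequence (P n) (v n))
    {k : ℕ → ℕ} (hk : Tendsto k atTop atTop)
    (ho : (fun n => (k n : ℝ)) =o[atTop] fun n => (n : ℝ)) {ε : ℝ} (hε : 0 < ε) :
    Tendsto (fun n => P n {ω | connTime (fun i => v n i ω) (k n) ≤
      (n + ⌊(1 + ε) * (k n * Real.logb (Fintype.card F) (n / k n))⌋₊ : ℕ)}ᶜ) atTop (𝓝 0) := by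
  set q : ℝ := (Fintype.card F : ℝ) with hq
  have hq2' : 2 ≤ Fintype.card F := Fintype.one_lt_card
  have hq2 : 2 ≤ q := by rw [hq]; exact_mod_cast hq2'
  have hy := tendsto_div_atTop_of_isLittleO hk ho
  -- With `y = n/k` these conditions give in turn `4k ≤ n`, `k ≤ d`, `d ≤ n`, and `(2eqy)^k ≤ 4^(-k)
  -- y^((1+ε)k)`, where `8 = 2 * 4`; the spare `4^(-k)` beats the `2k` of the union bound.
  have hlarge : ∀ᶠ y : ℝ in atTop, 4 ≤ y ∧ 2 ≤ Real.logb q y ∧ (1 + ε) * Real.logb q y ≤ y ∧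
      8 * Real.exp 1 * q ≤ y ^ ε := by
    have h1 := (Real.tendsto_logb_atTop (by linarith : 1 < q)).eventually_ge_atTop 2
    have h2 := (Real.isLittleO_logb_id_atTop (b := q)).bound (show 0 < (1 + ε)⁻¹ by positivity)
    have h3 := (tendsto_rpow_atTop hε).eventually_ge_atTop (8 * Real.exp 1 * q)
    filter_upwards [h1, h2, h3, eventually_ge_atTop 4] with y h1 h2 h3 h4
    refine ⟨h4, h1, ?_, h3⟩
    rw [Real.norm_of_nonneg (by linarith), id, Real.norm_of_nonneg (by linarith)] at h2
    calc (1 + ε) * Real.logb q y ≤ (1 + ε) * ((1 + ε)⁻¹ * y) := by gcongr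
      _ = y := by field_simp
  have hθ : Tendsto (fun n => 2 * q * (1 / 4 : ℝ) ^ k n) atTop (𝓝 0) := by
    have h := (tendsto_pow_atTop_nhds_zero_of_lt_one (r := (1 / 4 : ℝ)) (by norm_num)
      (by norm_num)).comp hk
    simpa using h.const_mul (2 * q)
  have hb : Tendsto (fun n => q⁻¹ ^ k n + 2 * k n * (2 * q * (1 / 4 : ℝ) ^ k n)) atTop (𝓝 0) := by
    have h := (tendsto_self_mul_const_pow_of_lt_one (r := (1 / 4 : ℝ)) (by norm_num)
      (by norm_num)).comp hk
    have h1 := (tendsto_inv_card_pow (F := F) hk).add (h.const_mul (4 * q))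
    rw [mul_zero, add_zero] at h1
    refine h1.congr fun n => ?_
    simp only [Function.comp]
    ring
  refine tendsto_compl_of_subset hb ?_
  filter_upwards [hy.eventually hlarge, hk.eventually_ge_atTop 16, eventually_ge_atTop 28,
    hθ.eventually_le_const (show (0 : ℝ) < 1 / 2 by norm_num)]
    with n ⟨hy4, hlog2, hlogy, hyε⟩ hk16 hn28 hθ2
  set y : ℝ := (n : ℝ) / k n with hydef
  set L : ℝ := k n * Real.logb q y with hL
  set d := ⌊(1 + ε) * L⌋₊ with hd
  have hkpos : (0 : ℝ) < k n := by exact_mod_cast (show 0 < k n by omega)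
  have hL0 : 0 ≤ L := by positivity
  have h4k : 4 * k n ≤ n := by
    rw [hydef, le_div_iff₀ hkpos] at hy4
    exact_mod_cast hy4
  have hkd : k n ≤ d := by
    refine Nat.le_floor ?_
    have : (k n : ℝ) ≤ L := by rw [hL]; nlinarith
    nlinarith
  have hdn : d ≤ n := by
    refine Nat.floor_le_of_le ?_
    calc (1 + ε) * L = k n * ((1 + ε) * Real.logb q y) := by rw [hL]; ring
      _ ≤ k n * y := by gcongr
      _ = n := by rw [hydef]; field_simp
  have hbound : 2 * (Real.exp 1 * (n + d : ℕ) / k n) ^ k n * q⁻¹ ^ (d - k n) ≤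
      2 * q * (1 / 4 : ℝ) ^ k n := by
    have hy0 : 0 < y := by linarith
    have h1 : Real.exp 1 * (n + d : ℕ) / k n ≤ 2 * Real.exp 1 * y := by
      have : ((n + d : ℕ) : ℝ) ≤ 2 * n := by exact_mod_cast (show n + d ≤ 2 * n by omega)
      calc Real.exp 1 * (n + d : ℕ) / k n ≤ Real.exp 1 * (2 * n) / k n := by gcongr
        _ = 2 * Real.exp 1 * y := by rw [hydef]; ring
    -- The extra factor `q` pays for the floor in `d`.
    have h2 : y ^ ((1 + ε) * k n) ≤ q * q ^ d := by
      rw [← rpow_mul_logb (by linarith : 1 < q) hy0, ← pow_succ', ← Real.rpow_natCast]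
      refine Real.rpow_le_rpow_of_exponent_le (by linarith) ?_
      have := Nat.lt_floor_add_one ((1 + ε) * L)
      push_cast
      exact this.le
    have h3 : y ^ ((1 + ε) * k n) = (y * y ^ ε) ^ k n := by
      rw [Real.rpow_mul_natCast hy0.le, Real.rpow_add hy0, Real.rpow_one]
    have h4 : q⁻¹ ^ (d - k n) = q ^ k n / q ^ d := by
      rw [inv_pow, eq_div_iff (by positivity), inv_mul_eq_iff_eq_mul₀ (by positivity), ← pow_add]
      congr 1; omega
    have h5 : (8 * Real.exp 1 * q * y) ^ k n ≤ q * q ^ d := by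
      refine le_trans ?_ h2
      rw [h3]
      refine pow_le_pow_left₀ (by positivity) ?_ _
      rw [mul_comm y]
      gcongr
    rw [h4, mul_div_assoc', div_le_iff₀ (by positivity)]
    calc 2 * (Real.exp 1 * (n + d : ℕ) / k n) ^ k n * q ^ k n
        ≤ 2 * (2 * Real.exp 1 * y) ^ k n * q ^ k n := by gcongr
      _ = 2 * (1 / 4 : ℝ) ^ k n * (8 * Real.exp 1 * q * y) ^ k n := by
          rw [mul_assoc 2 (_ ^ k n) (q ^ k n), mul_assoc 2 (_ ^ k n) (_ ^ k n), ← mul_pow, ← mul_pow]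
          congr 2; ring
      _ ≤ 2 * (1 / 4 : ℝ) ^ k n * (q * q ^ d) := by gcongr
      _ = _ := by ring
  let S₁ : Set (Matrix (Fin n) (Fin (n + d)) F) := {A | ∃ y, y ≠ 0 ∧ Matrix.vecMul y A = 0}
  let S₂ : Set (Matrix (Fin n) (Fin (n + d)) F) :=
    {A | A.rank = n ∧ ¬ IsVerticallyConnected (representedMatroid A) (k n)}
  refine ⟨{ω | columnMatrix (fun i => v n i ω) (n + d) ∈ S₁} ∪
    {ω | columnMatrix (fun i => v n i ω) (n + d) ∈ S₂}, ?_, ?_⟩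
  · rw [Set.compl_subset_comm]
    intro ω hω
    simp only [Set.mem_compl_iff, Set.mem_union, Set.mem_ofPred_eq, not_or, S₁, S₂] at hω
    push Not at hω
    have hrank := rank_eq_of_vecMul_ne_zero hω.1
    rw [Fintype.card_fin] at hrank
    exact connTime_le (by omega) (hω.2 hrank)
  · have h1 : dens S₁ ≤ q⁻¹ ^ k n := by
      refine dens_exists_vecMul_eq_zero_le.trans ?_
      rw [Fintype.card_fin, Fintype.card_fin, ← hq, pow_add, ← mul_assoc, ← mul_pow,
        mul_inv_cancel₀ (by positivity), one_pow, one_mul]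
      exact pow_le_pow_of_le_one (by positivity) (inv_le_one_of_one_le₀ (by linarith)) hkd
    have h2 : dens S₂ ≤ 2 * k n * (2 * q * (1 / 4 : ℝ) ^ k n) :=
      dens_not_isVerticallyConnected_le rfl hkd hk16 h4k (by omega)
        (fun j => four_mul_le_of_pow_le hq2' hn28) hbound hθ2
    refine (measure_union_le _ _).trans ?_
    rw [measure_columnMatrix_mem (hv n), measure_columnMatrix_mem (hv n),
      ← ENNReal.ofReal_add (dens_nonneg _) (dens_nonneg _)]
    exact ENNReal.ofReal_le_ofReal (by linarith)

lemma aas_abs_connTime_sub_le (hv : ∀ n, IsUniformColumnSequence (P n) (v n))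
    {k : ℕ → ℕ} (hk : Tendsto k atTop atTop)
    (ho : (fun n => (k n : ℝ)) =o[atTop] fun n => (n : ℝ)) {ε : ℝ} (hε : 0 < ε) :
    AAS P fun n => {ω | ∃ τ : ℕ, connTime (fun i => v n i ω) (k n) = τ ∧
      |((τ : ℝ) - n) - k n * Real.logb (Fintype.card F) (n / k n)| ≤
        ε * (k n * Real.logb (Fintype.card F) (n / k n))} := by
  -- Capping `ε` at `1` keeps `(1 - ε) L` nonnegative, as the floor in the lower bound requires.
  have hε' : 0 < min ε 1 := lt_min hε one_pos
  refine AAS.of_tendsto_compl (tendsto_compl_mono (tendsto_compl_inter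
    (tendsto_compl_le_connTime_of_isLittleO hv hk ho hε' (min_le_right _ _))
    (tendsto_compl_connTime_le_of_isLittleO hv hk ho hε')) ?_)
  filter_upwards [(tendsto_div_atTop_of_isLittleO hk ho).eventually_ge_atTop 1] with n hy
  rintro ω ⟨h1, h2⟩
  rw [Set.mem_ofPred_eq] at h1 h2
  have hL0 : 0 ≤ k n * Real.logb (Fintype.card F) (n / k n) :=
    mul_nonneg (Nat.cast_nonneg _)
      (Real.logb_nonneg (by exact_mod_cast Fintype.one_lt_card) hy)
  set L := k n * Real.logb (Fintype.card F) (n / k n)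
  obtain ⟨τ, hτ⟩ := ENat.ne_top_iff_exists.1 (ne_top_of_le_ne_top (ENat.natCast_ne_top _) h2)
  refine ⟨τ, hτ.symm, ?_⟩
  rw [← hτ, Nat.cast_le] at h1 h2
  have h1' : ((n + ⌊(1 - min ε 1) * L⌋₊ + 1 : ℕ) : ℝ) ≤ τ := by exact_mod_cast h1
  have h2' : (τ : ℝ) ≤ (n + ⌊(1 + min ε 1) * L⌋₊ : ℕ) := by exact_mod_cast h2
  push_cast at h1' h2'
  have h3 := Nat.lt_floor_add_one ((1 - min ε 1) * L)
  have h4 := Nat.floor_le (show 0 ≤ (1 + min ε 1) * L by positivity)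
  have h5 : min ε 1 * L ≤ ε * L := mul_le_mul_of_nonneg_right (min_le_left _ _) hL0
  rw [abs_le]
  constructor <;> linarith

end Sublinear

theorem mainTheorem9 {F : Type*} [Field F] [Fintype F]
    [MeasurableSpace F] [DiscreteMeasurableSpace F]
    {Ω : ℕ → Type*} [∀ n, MeasurableSpace (Ω n)]
    (P : ∀ n, Measure (Ω n)) [∀ n, IsProbabilityMeasure (P n)]
    (v : ∀ n, ℕ → Ω n → Fin n → F)
    (hv : ∀ n, IsUniformColumnSequence (P n) (v n)) :
    (∀ k : ℕ → ℕ, Tendsto k atTop atTop →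
      ((fun n => (k n : ℝ)) =o[atTop] fun n => (n : ℝ)) →
      ∀ ε : ℝ, 0 < ε →
        AAS P fun n => {ω | ∃ τ : ℕ, connTime (fun i => v n i ω) (k n) = τ ∧
          |((τ : ℝ) - n) - k n * Real.logb (Fintype.card F) (n / k n)| ≤
            ε * (k n * Real.logb (Fintype.card F) (n / k n))}) ∧
    (∀ (k : ℕ → ℕ) (t : ℝ), 0 < t → t < 1 →
      Tendsto (fun n => (k n : ℝ) / n) atTop (𝓝 t) →
      ∀ α : ℝ,
        0 < t * Real.log ((1 + α) / t) +
            (1 + α - t) * Real.log ((1 + α) / (1 + α - t)) +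
            t * Real.log ((Fintype.card F : ℝ) - 1) - α * Real.log (Fintype.card F) →
        AAS P fun n => {ω | ∀ τ : ℕ, connTime (fun i => v n i ω) (k n) = τ →
          (1 + α) * n ≤ τ}) := by
  refine ⟨fun k hk ho ε hε => aas_abs_connTime_sub_le hv hk ho hε, ?_⟩
  intro k t ht0 ht1 hk α hpos
  -- For `α < 0` the claim follows from the case `α = 0`, where the exponent is positive for every
  -- `t` in `(0,1)`.
  rcases le_total 0 α with hα | hα
  · exact AAS.of_tendsto_compl (tendsto_compl_mul_le_connTime hv ht0 ht1 hα hk hpos)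
  · have hq : (1 : ℝ) ≤ (Fintype.card F : ℝ) - 1 := by
      have : (2 : ℝ) ≤ Fintype.card F := by
        exact_mod_cast (show 2 ≤ Fintype.card F from Fintype.one_lt_card)
      linarith
    have h1 : 0 < t * Real.log (1 / t) :=
      mul_pos ht0 (Real.log_pos ((one_lt_div ht0).2 ht1))
    have h2 : 0 < (1 - t) * Real.log (1 / (1 - t)) :=
      mul_pos (by linarith) (Real.log_pos ((one_lt_div (by linarith)).2 (by linarith)))
    have h3 : 0 ≤ t * Real.log ((Fintype.card F : ℝ) - 1) :=
      mul_nonneg ht0.le (Real.log_nonneg hq)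
    refine AAS.of_tendsto_compl (tendsto_compl_mono
      (tendsto_compl_mul_le_connTime hv ht0 ht1 le_rfl hk ?_) (Eventually.of_forall ?_))
    · simp only [add_zero, zero_mul, sub_zero]
      linarith
    · intro n ω hω τ hτ
      refine le_trans ?_ (hω τ hτ)
      gcongr
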